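/- Let $n\ge 1$ and $k\ge 2$ be integers, and let $q\in\mathbb C^\times$ be such that either $q$ is not a root of unity or the smallest positive integer $\ell$ with $q^{2\ell}=1$ satisfies $\ell>k$. Put $\beta=q+q^{-1}$ and $[m]=(q^m-q^{-m})/(q-q^{-1})$. An $(N,d)$-diagram consists of $N$ marked points on the left side and $d$ marked points on the right side of a rectangle, joined pairwise by non-crossing links; it is monic if it has $d$ links crossing from left to right. Let $\mathsf{TL}_{N}(\beta)$ be the Temperley-Lieb algebra: the complex span of the $(N,N)$-diagrams, multiplied by concatenation, each closed loop being replaced by a factor $\beta$. Let $*$ be the linear extension of the reflection of diagrams through a vertical mirror, and let $E_i$ ($1\le i<N$) be the diagram which joins the $i$-th and $(i+1)$-st points (from the top) on each side and is straight elsewhere. For $N=n+k$ let $P_k\in\mathsf{TL}_{n+k}(\beta)$ be the Wenzl-Jones projector on the bottom $k$ points, given by $P_1=1$ and $P_j=P_{j-1}-\frac{[j-1]}{[j]}P_{j-1}E_{n+k-j+1}P_{j-1}$ for $1<j\le k$. A cellular datum $(\Delta,M,C,*)$ of an $R$-algebra $A$ consists of a finite partially ordered set $\Delta$; finite sets $M(d)$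 for $d\in\Delta$; an injective map $C:\bigsqcup_{d\in\Delta}M(d)\times M(d)\to A$, $(s,t)\mapsto C^d(s,t)$, whose image is an $R$-basis of $A$; and an $R$-linear anti-involution $*$ of $A$ with $C^d(s,t)^*=C^d(t,s)$; such that for all $a\in A$, $d\in\Delta$ and $s\in M(d)$ there are $r_a(s',s)\in R$ ($s'\in M(d)$) with $aC^d(s,t)\equiv\sum_{s'\in M(d)}r_a(s',s)C^d(s',t)$ modulo $A^{<d}=\langle C^e(p,p')\mid e<d;\ p,p'\in M(e)\rangle_R$ for all $t\in M(d)$. The algebra $A$ is cellular if it admits a cellular datum. For $\mathsf{TL}_{n+k}(\beta)$, let $\Delta_{n+k}=\{d\in\mathbb N\mid d\le n+k,\ d\equiv n+k \bmod 2\}$ with the usual order, let $M(d)$ be the set of monic $(n+k,d)$-diagrams and let $C^d(s,t)=st^*$. For $d\in\Delta_{n+k}$ let $N(d)$ be the set of those $s\in M(d)$ such that $P_kC^d(s,t)P_k\in\mathsf{TL}_{n+k}(\beta)^{<d}$ for all $t\in M(d)$. Then $P_k$ is idempotent, and the boundary seam algebra $\mathsf B_{n,k}(\beta)=P_k\,\mathsf{TL}_{n+k}(\beta)\,P_k$,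 with identity $P_k$, is cellular. More precisely, a cellular datum of $\mathsf B_{n,k}(\beta)$ is given by the poset $\Delta_{n,k}=\{d\in\Delta_{n+k}\mid N(d)\ne M(d)\}$ with the order of $\Delta_{n+k}$, the sets $M_{n,k}(d)=M(d)\setminus N(d)$, the map $C_{n,k}^d(s,t)=P_k\,C^d(s,t)\,P_k$, and the restriction of $*$ to $\mathsf B_{n,k}(\beta)$. Moreover $$\Delta_{n,k}=\{d\in\mathbb N\mid d\equiv n+k \bmod 2,\ 0\le d\le n+k,\ n+d\ge k\}.$$ -/

import Mathlib

namespace TemperleyLieb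

section Partitions

variable {U V W : Type*}

theorem map_le_iff (r : Setoid U) (f : U → V) (t : Setoid V) :
    r.map f ≤ t ↔ r ≤ t.comap f := by
  constructor
  · intro h x y hxy
    exact h (Setoid.le_comap_map hxy)
  · intro h
    refine Setoid.eqvGen_le ?_
    rintro _ _ ⟨x, y, hxy, rfl, rfl⟩
    exact h hxy

theorem map_sup (r s : Setoid U) (f : U → V) : (r ⊔ s).map f = r.map f ⊔ s.map f :=
  (show GaloisConnection (fun r : Setoid U => r.map f) (fun t => t.comap f) from
    fun r t => map_le_iff r f t).l_sup

theorem map_map (r : Setoid U) (f : U → V) (g : V → W) : (r.map f).map g = r.map (g ∘ f) := by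
  refine eq_of_forall_ge_iff fun t => ?_
  simp only [map_le_iff]
  rfl

theorem map_rel (r : Setoid U) (f : U → V) {x y : U} (h : r x y) : r.map f (f x) (f y) :=
  Setoid.le_comap_map h

/-- Push-forward along an injective map, made explicit. -/
theorem map_iff (r : Setoid U) {f : U → V} (hf : Function.Injective f) (v w : V) :
    r.map f v w ↔ v = w ∨ ∃ x y, r x y ∧ f x = v ∧ f y = w := by
  constructor
  · intro h
    let t : Setoid V :=
      { r := fun v w => v = w ∨ ∃ x y, r x y ∧ f x = v ∧ f y = w
        iseqv := by
          refine ⟨fun v => Or.inl rfl, ?_, ?_⟩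
          · rintro v w (rfl | ⟨x, y, h, rfl, rfl⟩)
            · exact Or.inl rfl
            · exact Or.inr ⟨y, x, r.symm' h, rfl, rfl⟩
          · rintro u v w (rfl | ⟨x, y, h, rfl, rfl⟩) h2
            · exact h2
            · rcases h2 with rfl | ⟨x', y', h', hx, rfl⟩
              · exact Or.inr ⟨x, y, h, rfl, rfl⟩
              · rw [hf hx] at h'
                exact Or.inr ⟨x, y', r.trans' h h', rfl, rfl⟩ }
    have : r.map f ≤ t := (map_le_iff _ _ _).2 fun {x y} h => Or.inr ⟨x, y, h, rfl, rfl⟩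
    exact this h
  · rintro (rfl | ⟨x, y, h, rfl, rfl⟩)
    · exact Setoid.refl' _ _
    · exact map_rel r f h

theorem map_trivial (r : Setoid U) {f : U → V} (hf : Function.Injective f) {v w : V}
    (hv : v ∉ Set.range f) (h : r.map f v w) : v = w := by
  rcases (map_iff r hf v w).1 h with h | ⟨x, y, -, rfl, -⟩
  · exact h
  · exact absurd ⟨x, rfl⟩ hv

theorem comap_map_square {U₀ V' : Type*} (a : Setoid U) {g : U → V} {f : V' → V}
    {f₀ : U₀ → U} {g' : U₀ → V'} (hg : Function.Injective g) (hf : Function.Injective f)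
    (hg' : Function.Injective g') (comm : ∀ u, f (g' u) = g (f₀ u))
    (pb : ∀ v' u, f v' = g u → ∃ u₀, g' u₀ = v' ∧ f₀ u₀ = u) :
    (a.map g).comap f = (a.comap f₀).map g' := by
  ext v w
  rw [Setoid.comap_rel, map_iff a hg, map_iff _ hg']
  constructor
  · rintro (h | ⟨x, y, h, hx, hy⟩)
    · exact Or.inl (hf h)
    · obtain ⟨x₀, rfl, rfl⟩ := pb _ _ hx.symm
      obtain ⟨y₀, rfl, rfl⟩ := pb _ _ hy.symm
      exact Or.inr ⟨x₀, y₀, h, rfl, rfl⟩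
  · rintro (rfl | ⟨x, y, h, rfl, rfl⟩)
    · exact Or.inl rfl
    · exact Or.inr ⟨f₀ x, f₀ y, h, (comm _).symm, (comm _).symm⟩

theorem comap_sup_of_trivial {V' : Type*} {f : V' → V}
    (A B : Setoid V) (hB : ∀ v, v ∉ Set.range f → ∀ w, B v w → v = w) :
    (A ⊔ B).comap f = A.comap f ⊔ B.comap f := by
  classical
  apply le_antisymm
  · set K := A.comap f ⊔ B.comap f with hK
    have hAK : A.comap f ≤ K := le_sup_left
    have hBK : B.comap f ≤ K := le_sup_right
    let φ : V → Quotient K ⊕ Quotient A := fun v =>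
      if h : ∃ p, A (f p) v then Sum.inl (Quotient.mk K h.choose) else Sum.inr (Quotient.mk A v)
    have hφ : ∀ p v, A (f p) v → φ v = Sum.inl (Quotient.mk K p) := by
      intro p v hp
      have h : ∃ p, A (f p) v := ⟨p, hp⟩
      simp only [φ, dif_pos h]
      congr 1
      refine Quotient.sound (s := K) (hAK ?_)
      exact A.trans' h.choose_spec (A.symm' hp)
    have hA : A ≤ Setoid.ker φ := by
      intro v w hvw
      rw [Setoid.ker_def]
      by_cases h : ∃ p, A (f p) v
      · obtain ⟨p, hp⟩ := h
        rw [hφ p v hp, hφ p w (A.trans' hp hvw)]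
      · have h' : ¬ ∃ p, A (f p) w := fun ⟨p, hp⟩ => h ⟨p, A.trans' hp (A.symm' hvw)⟩
        simp only [φ, dif_neg h, dif_neg h']
        congr 1
        exact Quotient.sound (s := A) hvw
    have hB' : B ≤ Setoid.ker φ := by
      intro v w hvw
      rw [Setoid.ker_def]
      by_cases hv : v ∈ Set.range f
      · by_cases hw : w ∈ Set.range f
        · obtain ⟨p, rfl⟩ := hv
          obtain ⟨p', rfl⟩ := hw
          rw [hφ p _ (A.refl' _), hφ p' _ (A.refl' _)]
          congr 1
          exact Quotient.sound (s := K) (hBK hvw)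
        · rw [hB w hw v (B.symm' hvw)]
      · rw [hB v hv w hvw]
    intro p p' hpp
    have h1 : φ (f p) = φ (f p') := (sup_le hA hB' : A ⊔ B ≤ Setoid.ker φ) hpp
    rw [hφ p _ (A.refl' _), hφ p' _ (A.refl' _)] at h1
    exact Quotient.exact (Sum.inl_injective h1)
  · refine sup_le ?_ ?_
    · intro p p' h
      exact (le_sup_left : A ≤ A ⊔ B) h
    · intro p p' h
      exact (le_sup_right : B ≤ A ⊔ B) h

/-- The number of classes of `A` contained in `D`. -/
noncomputable def classesIn (A : Setoid V) (D : Set V) : ℕ :=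
  Set.ncard {c ∈ A.classes | c ⊆ D}

theorem mem_classes_eq {A : Setoid V} {c : Set V} (hc : c ∈ A.classes) {v : V} (hv : v ∈ c) :
    c = {w | A w v} := by
  obtain ⟨y, rfl⟩ := hc
  ext w
  exact ⟨fun h => A.trans' h (A.symm' hv), fun h => A.trans' h hv⟩

theorem mem_classes_nonempty {A : Setoid V} {c : Set V} (hc : c ∈ A.classes) : c.Nonempty := by
  obtain ⟨y, rfl⟩ := hc
  exact ⟨y, A.refl' y⟩

theorem classesIn_comap {V' : Type*} [Finite V] (f : V' → V) (J : Setoid V) (D : Set V)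
    (hD : (Set.range f)ᶜ ⊆ D) :
    classesIn J D = classesIn (J.comap f) (f ⁻¹' D) + classesIn J (Set.range f)ᶜ := by
  have hsplit : {c ∈ J.classes | c ⊆ D} =
      {c | c ∈ J.classes ∧ c ⊆ D ∧ (c ∩ Set.range f).Nonempty} ∪
        {c ∈ J.classes | c ⊆ (Set.range f)ᶜ} := by
    ext c
    constructor
    · rintro ⟨h1, h2⟩
      by_cases h : (c ∩ Set.range f).Nonempty
      · exact Or.inl ⟨h1, h2, h⟩
      · refine Or.inr ⟨h1, fun v hv hr => h ⟨v, hv, hr⟩⟩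
    · rintro (⟨h1, h2, -⟩ | ⟨h1, h2⟩)
      · exact ⟨h1, h2⟩
      · exact ⟨h1, h2.trans hD⟩
  have hdisj : Disjoint {c | c ∈ J.classes ∧ c ⊆ D ∧ (c ∩ Set.range f).Nonempty}
        {c ∈ J.classes | c ⊆ (Set.range f)ᶜ} := by
    rw [Set.disjoint_left]
    rintro c ⟨-, -, v, hv, hr⟩ ⟨-, h⟩
    exact h hv hr
  unfold classesIn
  rw [hsplit, Set.ncard_union_eq hdisj (Set.toFinite _) (Set.toFinite _)]
  congr 1
  have himg : {c ∈ (J.comap f).classes | c ⊆ f ⁻¹' D} = (fun c => f ⁻¹' c) ''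
      {c | c ∈ J.classes ∧ c ⊆ D ∧ (c ∩ Set.range f).Nonempty} := by
    ext c
    constructor
    · rintro ⟨⟨y, rfl⟩, h2⟩
      refine ⟨{w | J w (f y)}, ⟨⟨f y, rfl⟩, ?_, ⟨f y, J.refl' _, y, rfl⟩⟩, rfl⟩
      intro w hw
      by_cases hr : w ∈ Set.range f
      · obtain ⟨p, rfl⟩ := hr
        exact h2 hw
      · exact hD hr
    · rintro ⟨c, ⟨h1, h2, _, hv, p, rfl⟩, rfl⟩
      refine ⟨⟨p, ?_⟩, Set.preimage_mono h2⟩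
      rw [mem_classes_eq h1 hv]
      rfl
  rw [himg, Set.InjOn.ncard_image]
  rintro c ⟨h1, -, _, hv, p, rfl⟩ c' ⟨h1', -, -⟩ h
  have hp : f p ∈ c' := by
    have : p ∈ f ⁻¹' c := hv
    rw [show f ⁻¹' c = f ⁻¹' c' from h] at this
    exact this
  rw [mem_classes_eq h1 hv, mem_classes_eq h1' hp]

theorem classesIn_sup_of_trivial (A B : Setoid V) (I : Set V)
    (hB : ∀ v ∈ I, ∀ w, B v w → v = w) : classesIn (A ⊔ B) I = classesIn A I := by
  have key : ∀ v, {w | A w v} ⊆ I → {w | A w v} = {w | (A ⊔ B) w v} := by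
    intro v hv
    apply Set.Subset.antisymm
    · intro w hw
      exact (le_sup_left : A ≤ A ⊔ B) hw
    · intro w hw
      have hle : A ⊔ B ≤ Setoid.ker (fun w => A w v) := by
        refine sup_le ?_ ?_
        · intro x y hxy
          exact propext ⟨fun h => A.trans' (A.symm' hxy) h, fun h => A.trans' hxy h⟩
        · intro x y hxy
          refine propext ⟨fun h => ?_, fun h => ?_⟩
          · rw [← hB x (hv h) y hxy]; exact h
          · rw [← hB y (hv h) x (B.symm' hxy)]; exact h
      have : (A w v) = (A v v) := hle hw
      exact this.mpr (A.refl' v)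
  unfold classesIn
  congr 1
  ext c
  constructor
  · rintro ⟨⟨v, rfl⟩, h⟩
    have hsub : {w | A w v} ⊆ I :=
      fun w hw => h ((le_sup_left : A ≤ A ⊔ B) hw)
    refine ⟨⟨v, (key v hsub).symm⟩, h⟩
  · rintro ⟨⟨v, rfl⟩, h⟩
    exact ⟨⟨v, key v h⟩, h⟩

theorem classesIn_map (a : Setoid U) {g : U → V} (hg : Function.Injective g) (I : Set U) :
    classesIn (a.map g) (g '' I) = classesIn a I := by
  unfold classesIn
  have : {c ∈ (a.map g).classes | c ⊆ g '' I} = (fun c => g '' c) '' {c ∈ a.classes | c ⊆ I} := by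
    have hcl : ∀ u, {w | a.map g w (g u)} = g '' {w | a w u} := by
      intro u
      ext w
      constructor
      · intro h
        rcases (map_iff a hg _ _).1 h with rfl | ⟨x, y, hxy, rfl, hy⟩
        · exact ⟨u, a.refl' u, rfl⟩
        · obtain rfl := hg hy
          exact ⟨x, hxy, rfl⟩
      · rintro ⟨x, hx, rfl⟩
        exact map_rel a g hx
    ext c
    constructor
    · rintro ⟨⟨v, rfl⟩, h⟩
      obtain ⟨u, hu, rfl⟩ := h (show a.map g v v from Setoid.refl' _ _)
      rw [hcl] at h ⊢
      exact ⟨_, ⟨⟨u, rfl⟩, (Set.image_subset_image_iff hg).1 h⟩, rfl⟩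
    · rintro ⟨_, ⟨⟨u, rfl⟩, h⟩, rfl⟩
      exact ⟨⟨g u, (hcl u).symm⟩, Set.image_mono h⟩
  rw [this, Set.ncard_image_of_injective _ hg.image_injective]

end Partitions
section Composition

variable {X Y Z W : Type*}

/-- Inclusion of the boundary of the left box into the points of the concatenation. -/
def inLeft : X ⊕ Y → X ⊕ (Y ⊕ Z) := Sum.map id Sum.inl

/-- Inclusion of the boundary of the right box into the points of the concatenation. -/
def inRight : Y ⊕ Z → X ⊕ (Y ⊕ Z) := Sum.inr

/-- Inclusion of the outer points into the points of the concatenation. -/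
def inOuter : X ⊕ Z → X ⊕ (Y ⊕ Z) := Sum.map id Sum.inr

/-- The middle points of the concatenation. -/
def middle : Set (X ⊕ (Y ⊕ Z)) := Set.range (Sum.inr ∘ Sum.inl)

/-- The relation "connected in the concatenation": the middle points of the two pictures
are identified, and the links of both pictures are used. -/
def concat (r : Setoid (X ⊕ Y)) (s : Setoid (Y ⊕ Z)) : Setoid (X ⊕ (Y ⊕ Z)) :=
  r.map inLeft ⊔ s.map inRight

/-- The connections between outer points in the concatenation. -/
def compRel (r : Setoid (X ⊕ Y)) (s : Setoid (Y ⊕ Z)) : Setoid (X ⊕ Z) :=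
  (concat r s).comap inOuter

/-- The number of closed loops in the concatenation, that is, of connected components
which consist of middle points only. -/
noncomputable def loops (r : Setoid (X ⊕ Y)) (s : Setoid (Y ⊕ Z)) : ℕ :=
  Set.ncard {c ∈ (concat r s).classes | c ⊆ middle}

theorem inLeft_injective : Function.Injective (inLeft : X ⊕ Y → X ⊕ (Y ⊕ Z)) :=
  Sum.map_injective.2 ⟨Function.injective_id, Sum.inl_injective⟩

theorem inRight_injective : Function.Injective (inRight : Y ⊕ Z → X ⊕ (Y ⊕ Z)) :=
  Sum.inr_injective

theorem inOuter_injective : Function.Injective (inOuter : X ⊕ Z → X ⊕ (Y ⊕ Z)) :=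
  Sum.map_injective.2 ⟨Function.injective_id, Sum.inr_injective⟩

/-- Connections in a triple concatenation. -/
def concat₃ (r : Setoid (X ⊕ Y)) (s : Setoid (Y ⊕ Z)) (t : Setoid (Z ⊕ W)) :
    Setoid (X ⊕ (Y ⊕ (Z ⊕ W))) :=
  (r.map inLeft ⊔ s.map (inRight ∘ inLeft)) ⊔ t.map (inRight ∘ inRight)

/-- Omit the first group of middle points. -/
def omit₁ : X ⊕ (Z ⊕ W) → X ⊕ (Y ⊕ (Z ⊕ W)) := Sum.map id Sum.inr

/-- Omit the second group of middle points. -/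
def omit₂ : X ⊕ (Y ⊕ W) → X ⊕ (Y ⊕ (Z ⊕ W)) := Sum.map id (Sum.map id Sum.inr)

/-- Omit the right outer points. -/
def omit₃ : X ⊕ (Y ⊕ Z) → X ⊕ (Y ⊕ (Z ⊕ W)) := Sum.map id (Sum.map id Sum.inl)

theorem omit₁_injective : Function.Injective (omit₁ : X ⊕ (Z ⊕ W) → X ⊕ (Y ⊕ (Z ⊕ W))) :=
  Sum.map_injective.2 ⟨Function.injective_id, Sum.inr_injective⟩

theorem omit₂_injective : Function.Injective (omit₂ : X ⊕ (Y ⊕ W) → X ⊕ (Y ⊕ (Z ⊕ W))) :=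
  Sum.map_injective.2 ⟨Function.injective_id,
    Sum.map_injective.2 ⟨Function.injective_id, Sum.inr_injective⟩⟩

theorem omit₃_injective : Function.Injective (omit₃ : X ⊕ (Y ⊕ Z) → X ⊕ (Y ⊕ (Z ⊕ W))) :=
  Sum.map_injective.2 ⟨Function.injective_id,
    Sum.map_injective.2 ⟨Function.injective_id, Sum.inl_injective⟩⟩

theorem concat₃_left (r : Setoid (X ⊕ Y)) (s : Setoid (Y ⊕ Z)) (t : Setoid (Z ⊕ W)) :
    concat₃ r s t = (concat r s).map omit₃ ⊔ t.map (inRight ∘ inRight) := by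
  unfold concat₃ concat
  rw [map_sup, map_map, map_map]
  congr 2
  congr 1
  funext x
  rcases x with x | x <;> rfl

theorem concat₃_right (r : Setoid (X ⊕ Y)) (s : Setoid (Y ⊕ Z)) (t : Setoid (Z ⊕ W)) :
    concat₃ r s t = (concat s t).map inRight ⊔ r.map inLeft := by
  unfold concat₃ concat
  rw [map_sup, map_map, map_map, sup_assoc, sup_comm]

theorem comap_omit₁ (r : Setoid (X ⊕ Y)) (s : Setoid (Y ⊕ Z)) (t : Setoid (Z ⊕ W)) :
    (concat₃ r s t).comap omit₁ = concat (compRel r s) t := by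
  rw [concat₃_left, comap_sup_of_trivial]
  · unfold concat
    congr 1
    · refine comap_map_square (f₀ := inOuter) _ omit₃_injective omit₁_injective inLeft_injective
        ?_ ?_
      · rintro (x | z) <;> rfl
      · rintro (x | z | w) (x' | y | z') h
        · cases h; exact ⟨Sum.inl x, rfl, rfl⟩
        · cases h
        · cases h
        · cases h
        · cases h
        · cases h; exact ⟨Sum.inr z, rfl, rfl⟩
        · cases h
        · cases h
        · cases h
    · rw [show (inRight ∘ inRight : Z ⊕ W → X ⊕ (Y ⊕ (Z ⊕ W))) = omit₁ ∘ inRight from rfl,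
        ← map_map, Setoid.comap_map_eq _ _ omit₁_injective]
  · intro v hv w h
    refine map_trivial t (inRight_injective.comp inRight_injective) ?_ h
    rintro ⟨x, rfl⟩
    exact hv ⟨inRight x, rfl⟩

theorem comap_omit₂ (r : Setoid (X ⊕ Y)) (s : Setoid (Y ⊕ Z)) (t : Setoid (Z ⊕ W)) :
    (concat₃ r s t).comap omit₂ = concat r (compRel s t) := by
  rw [concat₃_right, comap_sup_of_trivial]
  · unfold concat
    rw [sup_comm]
    congr 1
    · have : (inLeft : X ⊕ Y → X ⊕ (Y ⊕ (Z ⊕ W))) = omit₂ ∘ inLeft := by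
        funext x
        rcases x with x | x <;> rfl
      rw [this, ← map_map, Setoid.comap_map_eq _ _ omit₂_injective]
    · refine comap_map_square (f₀ := inOuter) _ inRight_injective omit₂_injective
        inRight_injective ?_ ?_
      · rintro (x | z) <;> rfl
      · rintro (x | y | w) (y' | z | w') h
        · cases h
        · cases h
        · cases h
        · cases h; exact ⟨Sum.inl y, rfl, rfl⟩
        · cases h
        · cases h
        · cases h
        · cases h
        · cases h; exact ⟨Sum.inr w, rfl, rfl⟩
  · intro v hv w h
    refine map_trivial r inLeft_injective ?_ h
    rintro ⟨x | y, rfl⟩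
    · exact hv ⟨Sum.inl x, rfl⟩
    · exact hv ⟨Sum.inr (Sum.inl y), rfl⟩

theorem compRel_assoc (r : Setoid (X ⊕ Y)) (s : Setoid (Y ⊕ Z)) (t : Setoid (Z ⊕ W)) :
    compRel (compRel r s) t = compRel r (compRel s t) := by
  ext v w
  change concat (compRel r s) t (inOuter v) (inOuter w) ↔
    concat r (compRel s t) (inOuter v) (inOuter w)
  rw [← comap_omit₁, ← comap_omit₂]
  rcases v with v | v <;> rcases w with w | w <;> rfl

theorem loops_assoc [Finite X] [Finite Y] [Finite Z] [Finite W]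
    (r : Setoid (X ⊕ Y)) (s : Setoid (Y ⊕ Z)) (t : Setoid (Z ⊕ W)) :
    loops r s + loops (compRel r s) t = loops s t + loops r (compRel s t) := by
  let mid : Set (X ⊕ (Y ⊕ (Z ⊕ W))) := {v | ∃ u : Y ⊕ Z, v = Sum.inr (Sum.map id Sum.inl u)}
  have h₁ : classesIn (concat₃ r s t) mid = loops (compRel r s) t + loops r s := by
    rw [classesIn_comap omit₁]
    · congr 1
      · have : omit₁ ⁻¹' mid = middle := by
          ext (x | z | w) <;> simp [mid, middle, omit₁]
        rw [comap_omit₁, this]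
        rfl
      · have : (Set.range (omit₁ : X ⊕ (Z ⊕ W) → X ⊕ (Y ⊕ (Z ⊕ W))))ᶜ = omit₃ '' middle := by
          ext (x | y | z | w) <;> simp [middle, omit₁, omit₃]
        rw [concat₃_left, classesIn_sup_of_trivial, this, classesIn_map _ omit₃_injective]
        · rfl
        · intro v hv w h
          refine map_trivial t (inRight_injective.comp inRight_injective) ?_ h
          rintro ⟨x, rfl⟩
          exact hv ⟨inRight x, rfl⟩
    · rintro (x | y | z | w) <;> simp [mid, omit₁]
  have h₂ : classesIn (concat₃ r s t) mid = loops r (compRel s t) + loops s t := by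
    rw [classesIn_comap omit₂]
    · congr 1
      · have : omit₂ ⁻¹' mid = middle := by
          ext (x | z | w) <;> simp [mid, middle, omit₂]
        rw [comap_omit₂, this]
        rfl
      · have : (Set.range (omit₂ : X ⊕ (Y ⊕ W) → X ⊕ (Y ⊕ (Z ⊕ W))))ᶜ = inRight '' middle := by
          ext (x | y | z | w) <;> simp [middle, omit₂, inRight]
        rw [concat₃_right, classesIn_sup_of_trivial, this, classesIn_map _ inRight_injective]
        · rfl
        · intro v hv w h
          refine map_trivial r inLeft_injective ?_ h
          rintro ⟨x | y, rfl⟩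
          · exact hv ⟨Sum.inl x, rfl⟩
          · exact hv ⟨Sum.inr (Sum.inl y), rfl⟩
    · rintro (x | y | z | w) <;> simp [mid, omit₂]
  omega

/-- Mirror image: left and right are exchanged. -/
def flipRel (r : Setoid (X ⊕ Y)) : Setoid (Y ⊕ X) := r.comap Sum.swap

/-- Straight lines. -/
def idRel (X : Type*) : Setoid (X ⊕ X) := Setoid.ker (Sum.elim id id)

theorem concat_id_left (s : Setoid (X ⊕ Z)) :
    concat (idRel X) s = s.comap (Sum.elim Sum.inl id) := by
  apply le_antisymm
  · refine sup_le ?_ ?_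
    · rw [map_le_iff]
      rintro (x | x) (y | y) h <;>
      · obtain rfl : x = y := h
        exact s.refl' _
    · rw [map_le_iff]
      intro x y h
      exact h
  · have h0 : ∀ v : X ⊕ (X ⊕ Z), concat (idRel X) s v (Sum.inr (Sum.elim Sum.inl id v)) := by
      rintro (x | v)
      · exact (le_sup_left : _ ≤ concat (idRel X) s)
          (map_rel (idRel X) inLeft (x := Sum.inl x) (y := Sum.inr x) rfl)
      · exact Setoid.refl' _ _
    intro v w h
    refine Setoid.trans' _ (h0 v) (Setoid.trans' _ ?_ (Setoid.symm' _ (h0 w)))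
    exact (le_sup_right : _ ≤ concat (idRel X) s) (map_rel s inRight h)

theorem compRel_id_left (s : Setoid (X ⊕ Z)) : compRel (idRel X) s = s := by
  unfold compRel
  rw [concat_id_left, ← Setoid.comap_comp]
  convert Setoid.comap_id s
  funext x
  rcases x with x | x <;> rfl

theorem loops_id_left [Finite X] [Finite Z] (s : Setoid (X ⊕ Z)) : loops (idRel X) s = 0 := by
  unfold loops
  rw [Set.ncard_eq_zero, Set.eq_empty_iff_forall_notMem]
  rintro c ⟨⟨v, rfl⟩, h⟩
  rw [concat_id_left] at h
  obtain ⟨x, rfl⟩ := @h v (s.refl' _)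
  obtain ⟨y, hy⟩ := h (show (Setoid.comap _ s) (Sum.inl x) _ from s.refl' _)
  cases hy

theorem concat_id_right (s : Setoid (X ⊕ Z)) :
    concat s (idRel Z) = s.comap (Sum.elim Sum.inl (Sum.elim Sum.inr Sum.inr)) := by
  apply le_antisymm
  · refine sup_le ?_ ?_
    · rw [map_le_iff]
      rintro (x | x) (y | y) h <;> exact h
    · rw [map_le_iff]
      rintro (x | x) (y | y) h <;>
      · obtain rfl : x = y := h
        exact s.refl' _
  · have h0 : ∀ v : X ⊕ (Z ⊕ Z), concat s (idRel Z) v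
        (inLeft ((Sum.elim Sum.inl (Sum.elim Sum.inr Sum.inr) : X ⊕ (Z ⊕ Z) → X ⊕ Z) v)) := by
      rintro (x | z | z)
      · exact Setoid.refl' _ _
      · exact Setoid.refl' _ _
      · exact (le_sup_right : _ ≤ concat s (idRel Z))
          (map_rel (idRel Z) inRight (x := Sum.inr z) (y := Sum.inl z) rfl)
    intro v w h
    refine Setoid.trans' _ (h0 v) (Setoid.trans' _ ?_ (Setoid.symm' _ (h0 w)))
    exact (le_sup_left : _ ≤ concat s (idRel Z)) (map_rel s inLeft h)

theorem compRel_id_right (s : Setoid (X ⊕ Z)) : compRel s (idRel Z) = s := by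
  unfold compRel
  rw [concat_id_right, ← Setoid.comap_comp]
  convert Setoid.comap_id s
  funext x
  rcases x with x | x <;> rfl

theorem loops_id_right [Finite X] [Finite Z] (s : Setoid (X ⊕ Z)) : loops s (idRel Z) = 0 := by
  unfold loops
  rw [Set.ncard_eq_zero, Set.eq_empty_iff_forall_notMem]
  rintro c ⟨⟨v, rfl⟩, h⟩
  rw [concat_id_right] at h
  obtain ⟨x, rfl⟩ := @h v (s.refl' _)
  obtain ⟨y, hy⟩ := h (show (Setoid.comap _ s) (Sum.inr (Sum.inr x)) _ from s.refl' _)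
  cases hy

end Composition
section Pairings

variable {V X Y Z : Type*}

/-- Every point is connected to exactly one other point. -/
def IsPairing (r : Setoid V) : Prop := ∀ x, ∃! y, y ≠ x ∧ r x y

/-- The other end of the link at `x`. -/
noncomputable def IsPairing.partner {r : Setoid V} (h : IsPairing r) (x : V) : V := (h x).choose

theorem IsPairing.partner_ne {r : Setoid V} (h : IsPairing r) (x : V) : h.partner x ≠ x :=
  (h x).choose_spec.1.1

theorem IsPairing.rel_partner {r : Setoid V} (h : IsPairing r) (x : V) : r x (h.partner x) :=
  (h x).choose_spec.1.2

theorem IsPairing.eq_partner {r : Setoid V} (h : IsPairing r) {x y : V} (hy : y ≠ x)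
    (hr : r x y) : y = h.partner x :=
  (h x).choose_spec.2 y ⟨hy, hr⟩

theorem IsPairing.partner_partner {r : Setoid V} (h : IsPairing r) (x : V) :
    h.partner (h.partner x) = x :=
  (h.eq_partner (h.partner_ne x).symm (r.symm' (h.rel_partner x))).symm

theorem IsPairing.rel_iff {r : Setoid V} (h : IsPairing r) (x y : V) :
    r x y ↔ y = x ∨ y = h.partner x := by
  constructor
  · intro hr
    by_cases hy : y = x
    · exact Or.inl hy
    · exact Or.inr (h.eq_partner hy hr)
  · rintro (rfl | rfl)
    · exact r.refl' _
    · exact h.rel_partner x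

/-- An orbit of two involutions without common fixed points which contains a point fixed by one
of them contains exactly two such points. -/
theorem existsUnique_endpoint [Finite V] (a b : Equiv.Perm V) (ha : a * a = 1) (hb : b * b = 1)
    (J : Setoid V) (hJa : ∀ v, J v (a v)) (hJb : ∀ v, J v (b v))
    (hJ : ∀ J' : Setoid V, (∀ v, J' v (a v)) → (∀ v, J' v (b v)) → J ≤ J')
    (x : V) (hx : b x = x) (hxa : a x ≠ x) :
    ∃! y, y ≠ x ∧ J x y ∧ (a y = y ∨ b y = y) := by
  have ha' : a⁻¹ = a := inv_eq_of_mul_eq_one_left ha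
  have hb' : b⁻¹ = b := inv_eq_of_mul_eq_one_left hb
  set ρ : Equiv.Perm V := b * a with hρ
  have hρi : ρ⁻¹ = a * b := by rw [hρ, mul_inv_rev, ha', hb']
  have hconja : ∀ i : ℤ, a * ρ ^ i = ρ ^ (-i) * a := by
    intro i
    have h1 : a * ρ * a⁻¹ = ρ⁻¹ := by
      rw [hρi, hρ, ha', mul_assoc, mul_assoc, ha, mul_one]
    have h2 := conj_zpow (i := i) (a := a) (b := ρ)
    rw [h1, inv_zpow, ← zpow_neg] at h2
    rw [h2, inv_mul_cancel_right]
  have hconjb : ∀ i : ℤ, b * ρ ^ i = ρ ^ (-i) * b := by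
    intro i
    have h1 : b * ρ * b⁻¹ = ρ⁻¹ := by
      rw [hρi, hρ, hb', ← mul_assoc, hb, one_mul]
    have h2 := conj_zpow (i := i) (a := b) (b := ρ)
    rw [h1, inv_zpow, ← zpow_neg] at h2
    rw [h2, inv_mul_cancel_right]
  have hax : a x = (ρ ^ (-1 : ℤ)) x := by
    rw [zpow_neg_one, hρi, Equiv.Perm.mul_apply, hx]
  have hai : ∀ i : ℤ, a ((ρ ^ i) x) = (ρ ^ (-i - 1)) x := by
    intro i
    rw [← Equiv.Perm.mul_apply, hconja, Equiv.Perm.mul_apply, hax, ← Equiv.Perm.mul_apply,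
      ← zpow_add]
    rfl
  have hbi : ∀ i : ℤ, b ((ρ ^ i) x) = (ρ ^ (-i)) x := by
    intro i
    rw [← Equiv.Perm.mul_apply, hconjb, Equiv.Perm.mul_apply, hx]
  have horb : ∀ v, J x v → ∃ i : ℤ, v = (ρ ^ i) x := by
    intro v hv
    have hle : J ≤ Setoid.ker (fun v => ∃ i : ℤ, v = (ρ ^ i) x) := by
      refine hJ _ (fun v => propext ⟨?_, ?_⟩) (fun v => propext ⟨?_, ?_⟩)
      · rintro ⟨i, rfl⟩
        exact ⟨_, hai i⟩
      · rintro ⟨i, hi⟩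
        refine ⟨_, (?_ : v = _).trans (hai i)⟩
        rw [← hi, ← Equiv.Perm.mul_apply, ha, Equiv.Perm.one_apply]
      · rintro ⟨i, rfl⟩
        exact ⟨_, hbi i⟩
      · rintro ⟨i, hi⟩
        refine ⟨_, (?_ : v = _).trans (hbi i)⟩
        rw [← hi, ← Equiv.Perm.mul_apply, hb, Equiv.Perm.one_apply]
    exact (show _ = _ from hle hv).mp ⟨0, rfl⟩
  have horb' : ∀ i : ℤ, J x ((ρ ^ i) x) := by
    have hstep : ∀ v, J v (ρ v) := fun v => J.trans' (hJa v) (hJb (a v))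
    have hstep' : ∀ v, J v (ρ⁻¹ v) := by
      intro v
      rw [hρi]
      exact J.trans' (hJb v) (hJa (b v))
    intro i
    induction i using Int.induction_on with
    | zero => exact J.refl' _
    | succ i ih =>
      rw [add_comm, zpow_add, zpow_one, Equiv.Perm.mul_apply]
      exact J.trans' ih (hstep _)
    | pred i ih =>
      rw [sub_eq_add_neg, add_comm, zpow_add, zpow_neg_one, Equiv.Perm.mul_apply]
      exact J.trans' ih (hstep' _)
  obtain ⟨L, hL0, hL⟩ : ∃ L : ℤ, 0 < L ∧ ∀ i j : ℤ, (ρ ^ i) x = (ρ ^ j) x ↔ L ∣ i - j := by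
    refine ⟨Function.minimalPeriod (ρ • ·) x, ?_, ?_⟩
    · have := Function.minimalPeriod_pos_of_mem_periodicPts (f := fun y : V => ρ • y) (x := x)
        (by
          have := Function.Injective.mem_periodicPts (f := ρ) ρ.injective x
          exact this)
      exact_mod_cast this
    · intro i j
      rw [← MulAction.zpow_smul_eq_iff_minimalPeriod_dvd, sub_eq_add_neg, add_comm, zpow_add,
        zpow_neg, mul_smul, inv_smul_eq_iff]
      rfl
  have hL1 : L ≠ 1 := by
    rintro rfl
    apply hxa
    rw [hax]
    exact (hL (-1) 0).2 (one_dvd _)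
  have hfix : ∀ i : ℤ, (a ((ρ ^ i) x) = (ρ ^ i) x ∨ b ((ρ ^ i) x) = (ρ ^ i) x) ↔
      (L ∣ 2 * i + 1 ∨ L ∣ 2 * i) := by
    intro i
    rw [hai, hbi, hL, hL, ← dvd_neg, ← dvd_neg (b := -i - i)]
    ring_nf
  have hne : ∀ i : ℤ, (ρ ^ i) x ≠ x ↔ ¬ L ∣ i := by
    intro i
    rw [not_iff_not]
    have := hL i 0
    rwa [sub_zero] at this
  refine ⟨(ρ ^ (L / 2)) x, ⟨?_, horb' _, ?_⟩, ?_⟩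
  · rw [hne]
    intro h
    have := Int.le_of_dvd (by omega) h
    omega
  · rw [hfix]
    rcases Int.even_or_odd' L with ⟨c, hc | hc⟩
    · right; exact ⟨1, by omega⟩
    · left; exact ⟨1, by omega⟩
  · rintro y ⟨h1, h2, h3⟩
    obtain ⟨i, rfl⟩ := horb y h2
    rw [hne] at h1
    rw [hfix] at h3
    rw [hL]
    rcases h3 with ⟨c, hc⟩ | ⟨c, hc⟩
    · rcases Int.even_or_odd' c with ⟨d, rfl | rfl⟩
      · exfalso
        have : L * (2 * d) = 2 * (L * d) := by ring
        omega
      · have : L * (2 * d + 1) = 2 * (L * d) + L := by ring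
        exact ⟨d, by omega⟩
    · rcases Int.even_or_odd' c with ⟨d, rfl | rfl⟩
      · exfalso
        have : L * (2 * d) = 2 * (L * d) := by ring
        exact h1 ⟨d, by omega⟩
      · have : L * (2 * d + 1) = 2 * (L * d) + L := by ring
        exact ⟨d, by omega⟩

theorem isPairing_compRel [Finite X] [Finite Y] [Finite Z] {r : Setoid (X ⊕ Y)}
    {s : Setoid (Y ⊕ Z)} (hr : IsPairing r) (hs : IsPairing s) : IsPairing (compRel r s) := by
  let fa : X ⊕ (Y ⊕ Z) → X ⊕ (Y ⊕ Z) := fun v => match v with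
    | Sum.inl x => inLeft (hr.partner (Sum.inl x))
    | Sum.inr (Sum.inl y) => inLeft (hr.partner (Sum.inr y))
    | Sum.inr (Sum.inr z) => Sum.inr (Sum.inr z)
  have hfa : ∀ u, fa (inLeft u) = inLeft (hr.partner u) := by rintro (x | y) <;> rfl
  let fb : X ⊕ (Y ⊕ Z) → X ⊕ (Y ⊕ Z) := fun v => match v with
    | Sum.inl x => Sum.inl x
    | Sum.inr u => inRight (hs.partner u)
  have hfb : ∀ u, fb (inRight u) = inRight (hs.partner u) := fun u => rfl
  have hia : Function.Involutive fa := by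
    rintro (x | y | z)
    · exact (hfa _).trans (congrArg inLeft (hr.partner_partner _))
    · exact (hfa _).trans (congrArg inLeft (hr.partner_partner _))
    · rfl
  have hib : Function.Involutive fb := by
    rintro (x | u)
    · rfl
    · exact (hfb _).trans (congrArg inRight (hs.partner_partner _))
  let a : Equiv.Perm (X ⊕ (Y ⊕ Z)) := hia.toPerm
  let b : Equiv.Perm (X ⊕ (Y ⊕ Z)) := hib.toPerm
  have ha : a * a = 1 := Equiv.ext hia
  have hb : b * b = 1 := Equiv.ext hib
  have hJa : ∀ v, concat r s v (a v) := by
    have hl : ∀ u, concat r s (inLeft u) (a (inLeft u)) := by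
      intro u
      rw [show a (inLeft u) = _ from hfa u]
      exact (le_sup_left : _ ≤ concat r s) (map_rel r inLeft (hr.rel_partner u))
    rintro (x | y | z)
    · exact hl (Sum.inl x)
    · exact hl (Sum.inr y)
    · exact Setoid.refl' _ _
  have hJb : ∀ v, concat r s v (b v) := by
    rintro (x | u)
    · exact Setoid.refl' _ _
    · exact (le_sup_right : _ ≤ concat r s) (map_rel s inRight (hs.rel_partner u))
  have hJ : ∀ J' : Setoid (X ⊕ (Y ⊕ Z)), (∀ v, J' v (a v)) → (∀ v, J' v (b v)) →
      concat r s ≤ J' := by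
    intro J' h1 h2
    refine sup_le ((map_le_iff _ _ _).2 ?_) ((map_le_iff _ _ _).2 ?_)
    · intro x y hxy
      rcases (hr.rel_iff x y).1 hxy with rfl | rfl
      · exact Setoid.refl' _ _
      · have := h1 (inLeft x)
        rwa [show a (inLeft x) = _ from hfa x] at this
    · intro x y hxy
      rcases (hs.rel_iff x y).1 hxy with rfl | rfl
      · exact Setoid.refl' _ _
      · exact h2 (inRight x)
  have haX : ∀ u, a (inLeft u) ≠ inLeft u := by
    intro u h
    rw [show a (inLeft u) = _ from hfa u] at h
    exact hr.partner_ne u (inLeft_injective h)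
  have hbZ : ∀ u, b (inRight u) ≠ inRight u := by
    intro u h
    exact hs.partner_ne u (inRight_injective h)
  have hend : ∀ v, (a v = v ∨ b v = v) ↔ v ∈ Set.range (inOuter : X ⊕ Z → X ⊕ (Y ⊕ Z)) := by
    rintro (x | y | z)
    · exact ⟨fun _ => ⟨Sum.inl x, rfl⟩, fun _ => Or.inr rfl⟩
    · constructor
      · rintro (h | h)
        · exact absurd h (haX (Sum.inr y))
        · exact absurd h (hbZ (Sum.inl y))
      · rintro ⟨x | z, h⟩ <;> cases h
    · exact ⟨fun _ => ⟨Sum.inr z, rfl⟩, fun _ => Or.inl rfl⟩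
  have main : ∀ u : X ⊕ Z, ∃! w, w ≠ inOuter u ∧ concat r s (inOuter u) w ∧
      (a w = w ∨ b w = w) := by
    rintro (x | z)
    · exact existsUnique_endpoint a b ha hb _ hJa hJb hJ _ rfl (haX (Sum.inl x))
    · have := existsUnique_endpoint b a hb ha _ hJb hJa (fun J' h1 h2 => hJ J' h2 h1)
        (inOuter (Sum.inr z)) rfl (hbZ (Sum.inr z))
      simpa only [or_comm] using this
  intro u
  obtain ⟨w, ⟨h1, h2, h3⟩, h4⟩ := main u
  obtain ⟨w, rfl⟩ := (hend w).1 h3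
  refine ⟨w, ⟨fun h => h1 (congrArg inOuter h), h2⟩, ?_⟩
  rintro w' ⟨h5, h6⟩
  exact inOuter_injective (h4 _ ⟨fun h => h5 (inOuter_injective h), h6, (hend _).2 ⟨w', rfl⟩⟩)

end Pairings
section Planarity

variable {n m d : ℕ}

/-- Position of a marked point when the boundary of the rectangle is followed from the top left
corner, down the left side and then up the right side. Marked points are numbered from top to
bottom, those on the left side are `Sum.inl i`, those on the right side `Sum.inr j`. -/
def bdryPos : Fin n ⊕ Fin m → ℕ
  | Sum.inl i => i
  | Sum.inr j => n + (m - 1 - j)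

/-- No two links cross. -/
def IsPlanar (r : Setoid (Fin n ⊕ Fin m)) : Prop :=
  ∀ a b c d, bdryPos a < bdryPos b → bdryPos b < bdryPos c → bdryPos c < bdryPos d →
    r a c → r b d → False

theorem bdryPos_injective : Function.Injective (bdryPos : Fin n ⊕ Fin m → ℕ) := by
  rintro (i | i) (j | j) h <;> simp only [bdryPos] at h
  · exact congrArg Sum.inl (Fin.ext h)
  · omega
  · omega
  · exact congrArg Sum.inr (Fin.ext (by omega))

/-- `1` if `b` comes before `a`, and `0` otherwise. -/
def before (a b : Fin n ⊕ Fin m) : ZMod 2 := if bdryPos b < bdryPos a then 1 else 0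

theorem cross_parity (A A' B B' : ℕ) (n1 : A ≠ B) (n2 : A ≠ B') (n3 : A' ≠ B) (n4 : A' ≠ B')
    (c1 : ¬ (A < B ∧ B < A' ∧ A' < B')) (c2 : ¬ (A < B' ∧ B' < A' ∧ A' < B))
    (c3 : ¬ (A' < B ∧ B < A ∧ A < B')) (c4 : ¬ (A' < B' ∧ B' < A ∧ A < B))
    (c5 : ¬ (B < A ∧ A < B' ∧ B' < A')) (c6 : ¬ (B < A' ∧ A' < B' ∧ B' < A))
    (c7 : ¬ (B' < A ∧ A < B ∧ B < A')) (c8 : ¬ (B' < A' ∧ A' < B ∧ B < A)) :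
    (if B < A then (1 : ZMod 2) else 0) + (if B' < A then 1 else 0) +
      ((if B < A' then 1 else 0) + (if B' < A' then 1 else 0)) = 0 := by
  split_ifs <;> first | rfl | (exfalso; omega)

theorem before_cross {r : Setoid (Fin n ⊕ Fin m)} (h : IsPairing r) (hp : IsPlanar r)
    (p u : Fin n ⊕ Fin m) (hpu : ¬ r p u) :
    before p u + before p (h.partner u) +
      (before (h.partner p) u + before (h.partner p) (h.partner u)) = 0 := by
  have hP := h.rel_partner p
  have hU := h.rel_partner u
  have hP' := r.symm' hP
  have hU' := r.symm' hU
  have inj : ∀ x y : Fin n ⊕ Fin m, ¬ r x y → bdryPos x ≠ bdryPos y := by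
    intro x y hxy e
    rw [bdryPos_injective e] at hxy
    exact hxy (r.refl' _)
  refine cross_parity _ _ _ _ (inj _ _ hpu) (inj _ _ fun e => hpu (r.trans' e hU'))
    (inj _ _ fun e => hpu (r.trans' hP e))
    (inj _ _ fun e => hpu (r.trans' hP (r.trans' e hU'))) ?_ ?_ ?_ ?_ ?_ ?_ ?_ ?_
  · rintro ⟨e1, e2, e3⟩; exact hp _ _ _ _ e1 e2 e3 hP hU
  · rintro ⟨e1, e2, e3⟩; exact hp _ _ _ _ e1 e2 e3 hP hU'
  · rintro ⟨e1, e2, e3⟩; exact hp _ _ _ _ e1 e2 e3 hP' hU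
  · rintro ⟨e1, e2, e3⟩; exact hp _ _ _ _ e1 e2 e3 hP' hU'
  · rintro ⟨e1, e2, e3⟩; exact hp _ _ _ _ e1 e2 e3 hU hP
  · rintro ⟨e1, e2, e3⟩; exact hp _ _ _ _ e1 e2 e3 hU hP'
  · rintro ⟨e1, e2, e3⟩; exact hp _ _ _ _ e1 e2 e3 hU' hP
  · rintro ⟨e1, e2, e3⟩; exact hp _ _ _ _ e1 e2 e3 hU' hP'

theorem sum_eq_zero_of_partner {V : Type*} [Fintype V] {r : Setoid V} (h : IsPairing r)
    (g : V → ZMod 2) (hg : ∀ u, g u + g (h.partner u) = 0) : ∑ u, g u = 0 :=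
  Finset.sum_involution (fun u _ => h.partner u) (fun u _ => hg u)
    (fun u _ _ => h.partner_ne u) (fun _ _ => Finset.mem_univ _)
    (fun u _ => h.partner_partner u)

theorem sum_before {r : Setoid (Fin n ⊕ Fin m)} (h : IsPairing r) (hp : IsPlanar r)
    (s t : Fin n ⊕ Fin m → ZMod 2) (hs : ∀ u, s (h.partner u) = s u)
    (ht : ∀ u, t (h.partner u) = t u) (hst : ∀ p u, r p u → s p * t u = 0) :
    ∑ p, ∑ u, s p * t u * before p u = 0 := by
  refine sum_eq_zero_of_partner h _ fun p => ?_
  rw [← Finset.sum_add_distrib]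
  refine sum_eq_zero_of_partner h _ fun u => ?_
  rw [hs, ht]
  by_cases hr : r p u
  · rw [hst p u hr]; ring
  · have := before_cross h hp p u hr
    linear_combination s p * t u * this

theorem isPlanar_compRel {r : Setoid (Fin n ⊕ Fin m)} {s : Setoid (Fin m ⊕ Fin d)}
    (hr : IsPairing r) (hs : IsPairing s) (pr : IsPlanar r) (ps : IsPlanar s) :
    IsPlanar (compRel r s) := by
  classical
  have hc := isPairing_compRel hr hs
  intro a b c e hab hbc hce hac hbe
  have hab' : ¬ compRel r s a b := by
    intro h
    have h1 := hc.eq_partner (x := a) (y := b) (fun e => by rw [e] at hab; omega) h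
    have h2 := hc.eq_partner (x := a) (y := c) (fun e => by rw [e] at hbc; omega) hac
    rw [h1, h2] at hbc
    omega
  have hca : c = hc.partner a := hc.eq_partner (fun e => by rw [e] at hbc; omega) hac
  have heb : e = hc.partner b := hc.eq_partner (fun e => by rw [e] at hce; omega) hbe
  let J := concat r s
  let S : Fin n ⊕ (Fin m ⊕ Fin d) → ZMod 2 := fun v => if J (inOuter a) v then 1 else 0
  let T : Fin n ⊕ (Fin m ⊕ Fin d) → ZMod 2 := fun v => if J (inOuter b) v then 1 else 0
  have hJ1 : ∀ u v, r u v → J (inLeft u) (inLeft v) := fun u v h =>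
    (le_sup_left : _ ≤ concat r s) (map_rel r inLeft h)
  have hJ2 : ∀ u v, s u v → J (inRight u) (inRight v) := fun u v h =>
    (le_sup_right : _ ≤ concat r s) (map_rel s inRight h)
  have hinv : ∀ x u v, J u v → (if J (inOuter x) v then (1 : ZMod 2) else 0) =
      if J (inOuter x) u then 1 else 0 := by
    intro x u v h
    have : J (inOuter x) v ↔ J (inOuter x) u :=
      ⟨fun h' => J.trans' h' (J.symm' h), fun h' => J.trans' h' h⟩
    rw [if_congr this rfl rfl]
  have hdis : ∀ u v, J u v → S u * T v = 0 := by
    intro u v h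
    simp only [S, T]
    split_ifs with h1 h2
    · exact absurd (J.trans' h1 (J.trans' h (J.symm' h2))) hab'
    all_goals simp
  -- the parity identities for the two boxes
  have eA := sum_before hr pr (fun u => S (inLeft u)) (fun u => T (inLeft u))
    (fun u => hinv a _ _ (hJ1 _ _ (hr.rel_partner u)))
    (fun u => hinv b _ _ (hJ1 _ _ (hr.rel_partner u)))
    (fun p u h => hdis _ _ (hJ1 _ _ h))
  have eB := sum_before hs ps (fun u => S (inRight u)) (fun u => T (inRight u))
    (fun u => hinv a _ _ (hJ2 _ _ (hs.rel_partner u)))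
    (fun u => hinv b _ _ (hJ2 _ _ (hs.rel_partner u)))
    (fun p u h => hdis _ _ (hJ2 _ _ h))
  have pT : ∑ u, T (inLeft u) = 0 := sum_eq_zero_of_partner hr _ fun u => by
    rw [show T (inLeft (hr.partner u)) = T (inLeft u) from
      hinv b _ _ (hJ1 _ _ (hr.rel_partner u))]
    exact CharTwo.add_self_eq_zero _
  -- the corresponding sum over the outer points
  have eC : ∑ p : Fin n ⊕ Fin d, ∑ u : Fin n ⊕ Fin d,
      S (inOuter p) * T (inOuter u) * before p u = 1 := by
    have hS : ∀ g : Fin n ⊕ Fin d → ZMod 2, ∑ p, S (inOuter p) * g p = g a + g c := by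
      intro g
      have hac' : a ≠ c := fun e => by rw [e] at hab; omega
      rw [← Finset.sum_pair hac', ← Finset.sum_filter_add_sum_filter_not Finset.univ
        (fun p => p ∈ ({a, c} : Finset (Fin n ⊕ Fin d)))]
      rw [Finset.filter_mem_eq_inter, Finset.univ_inter,
        Finset.sum_eq_zero (s := Finset.univ.filter _), add_zero]
      · refine Finset.sum_congr rfl fun p hp => ?_
        have : J (inOuter a) (inOuter p) := by
          rw [Finset.mem_insert, Finset.mem_singleton] at hp
          rcases hp with rfl | rfl
          · exact J.refl' _
          · exact hac
        simp only [S, if_pos this, one_mul]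
      · intro p hp
        rw [Finset.mem_filter, Finset.mem_insert, Finset.mem_singleton] at hp
        have : ¬ J (inOuter a) (inOuter p) := by
          intro h
          rcases (hc.rel_iff a p).1 h with h | h
          · exact hp.2 (Or.inl h)
          · exact hp.2 (Or.inr (h.trans hca.symm))
        simp only [S, if_neg this, zero_mul]
    have hT : ∀ g : Fin n ⊕ Fin d → ZMod 2, ∑ p, T (inOuter p) * g p = g b + g e := by
      intro g
      have hbe' : b ≠ e := fun e => by rw [e] at hbc; omega
      rw [← Finset.sum_pair hbe', ← Finset.sum_filter_add_sum_filter_not Finset.univ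
        (fun p => p ∈ ({b, e} : Finset (Fin n ⊕ Fin d)))]
      rw [Finset.filter_mem_eq_inter, Finset.univ_inter,
        Finset.sum_eq_zero (s := Finset.univ.filter _), add_zero]
      · refine Finset.sum_congr rfl fun p hp => ?_
        have : J (inOuter b) (inOuter p) := by
          rw [Finset.mem_insert, Finset.mem_singleton] at hp
          rcases hp with rfl | rfl
          · exact J.refl' _
          · exact hbe
        simp only [T, if_pos this, one_mul]
      · intro p hp
        rw [Finset.mem_filter, Finset.mem_insert, Finset.mem_singleton] at hp
        have : ¬ J (inOuter b) (inOuter p) := by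
          intro h
          rcases (hc.rel_iff b p).1 h with h | h
          · exact hp.2 (Or.inl h)
          · exact hp.2 (Or.inr (h.trans heb.symm))
        simp only [T, if_neg this, zero_mul]
    simp_rw [mul_assoc, ← Finset.mul_sum]
    rw [hS, hT, hT]
    simp only [before]
    rw [if_neg (by omega), if_neg (by omega), if_pos (by omega), if_neg (by omega)]
    decide
  -- comparison
  have lX : ∀ x : Fin n, inLeft (Sum.inl x : Fin n ⊕ Fin m) =
    (Sum.inl x : Fin n ⊕ (Fin m ⊕ Fin d)) := fun _ => rfl
  have lY : ∀ y : Fin m, inLeft (Sum.inr y : Fin n ⊕ Fin m) =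
    (Sum.inr (Sum.inl y) : Fin n ⊕ (Fin m ⊕ Fin d)) := fun _ => rfl
  have oX : ∀ x : Fin n, inOuter (Sum.inl x : Fin n ⊕ Fin d) =
    (Sum.inl x : Fin n ⊕ (Fin m ⊕ Fin d)) := fun _ => rfl
  have oZ : ∀ z : Fin d, inOuter (Sum.inr z : Fin n ⊕ Fin d) =
    (Sum.inr (Sum.inr z) : Fin n ⊕ (Fin m ⊕ Fin d)) := fun _ => rfl
  have b1 : ∀ (N M : ℕ) (x x' : Fin N), before (Sum.inl x : Fin N ⊕ Fin M) (Sum.inl x') =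
      if x' < x then 1 else 0 := fun _ _ _ _ => rfl
  have b2 : ∀ (N M : ℕ) (x : Fin N) (y : Fin M),
      before (Sum.inl x : Fin N ⊕ Fin M) (Sum.inr y) = 0 := by
    intro N M x y
    exact if_neg (by simp only [bdryPos]; omega)
  have b3 : ∀ (N M : ℕ) (x : Fin N) (y : Fin M),
      before (Sum.inr y : Fin N ⊕ Fin M) (Sum.inl x) = 1 := by
    intro N M x y
    exact if_pos (by simp only [bdryPos]; omega)
  have b4 : ∀ (N M : ℕ) (y y' : Fin M), before (Sum.inr y : Fin N ⊕ Fin M) (Sum.inr y') =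
      if y < y' then 1 else 0 := by
    intro N M y y'
    exact if_congr (by simp only [bdryPos, Fin.lt_def]; omega) rfl rfl
  simp only [Fintype.sum_sum_type, lX, lY, oX, oZ, inRight, b1, b2, b3, b4, mul_zero, mul_one,
    Finset.sum_const_zero, Finset.sum_add_distrib] at eA eB eC pT
  have hYY : ∑ y : Fin m, ∑ y' : Fin m, S (Sum.inr (Sum.inl y)) * T (Sum.inr (Sum.inl y')) *
        (if y < y' then 1 else 0) +
      ∑ y : Fin m, ∑ y' : Fin m, S (Sum.inr (Sum.inl y)) * T (Sum.inr (Sum.inl y')) *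
        (if y' < y then 1 else 0) =
      (∑ y : Fin m, S (Sum.inr (Sum.inl y))) * ∑ y' : Fin m, T (Sum.inr (Sum.inl y')) := by
    rw [Finset.sum_mul_sum, ← Finset.sum_add_distrib]
    refine Finset.sum_congr rfl fun y _ => ?_
    rw [← Finset.sum_add_distrib]
    refine Finset.sum_congr rfl fun y' _ => ?_
    rcases lt_trichotomy y y' with h | rfl | h
    · rw [if_pos h, if_neg h.not_gt]; ring
    · rw [if_neg (lt_irrefl _), hdis _ _ (J.refl' _)]; ring
    · rw [if_pos h, if_neg h.not_gt]; ring
  simp only [← Finset.sum_mul_sum] at eA eB eC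
  exact absurd (show (1 : ZMod 2) = 0 by
    have h2 : (2 : ZMod 2) = 0 := by decide
    linear_combination eA + eB - eC - hYY -
      ((∑ y : Fin m, S (Sum.inr (Sum.inl y))) + ∑ z : Fin d, S (Sum.inr (Sum.inr z))) * pT +
      (∑ z : Fin d, S (Sum.inr (Sum.inr z))) * (∑ x : Fin n, T (Sum.inl x)) * h2) (by decide)

end Planarity
section Diagrams

variable {n m d e : ℕ}

/-- An `(n, m)`-diagram: `n` marked points on the left side of a rectangle and `m` on the right
side, connected pairwise by links which do not cross. -/
@[ext]
structure Diagram (n m : ℕ) where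
  /-- `rel x y` means that `x = y` or that a link joins `x` and `y` -/
  rel : Setoid (Fin n ⊕ Fin m)
  pairing : IsPairing rel
  planar : IsPlanar rel

instance : Finite (Diagram n m) := by
  refine Finite.of_injective (fun D : Diagram n m => fun x y => D.rel x y) fun D D' h => ?_
  refine Diagram.ext (Setoid.ext fun x y => ?_)
  exact iff_of_eq (congrFun (congrFun h x) y)

noncomputable instance : Fintype (Diagram n m) := Fintype.ofFinite _

/-- Concatenation, closed loops being removed. -/
def Diagram.comp (D : Diagram n m) (E : Diagram m d) : Diagram n d where
  rel := compRel D.rel E.rel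
  pairing := isPairing_compRel D.pairing E.pairing
  planar := isPlanar_compRel D.pairing E.pairing D.planar E.planar

/-- Reflection through a vertical mirror. -/
def Diagram.flip (D : Diagram n m) : Diagram m n where
  rel := flipRel D.rel
  pairing := by
    intro x
    obtain ⟨y, ⟨h1, h2⟩, h3⟩ := D.pairing x.swap
    refine ⟨y.swap, ⟨?_, ?_⟩, ?_⟩
    · rintro rfl
      exact h1 (Sum.swap_swap y).symm
    · change D.rel x.swap y.swap.swap
      rwa [Sum.swap_swap]
    · rintro z ⟨h4, h5⟩
      rw [← h3 z.swap ⟨fun h => h4 ?_, h5⟩, Sum.swap_swap]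
      rw [← Sum.swap_swap z, h, Sum.swap_swap]
  planar := by
    have hpos : ∀ x y : Fin m ⊕ Fin n, bdryPos x < bdryPos y →
        bdryPos y.swap < bdryPos x.swap := by
      rintro (x | x) (y | y) h <;> simp only [bdryPos, Sum.swap_inl, Sum.swap_inr] at h ⊢ <;> omega
    intro a b c e hab hbc hce hac hbe
    exact D.planar e.swap c.swap b.swap a.swap (hpos _ _ hce) (hpos _ _ hbc) (hpos _ _ hab)
      (D.rel.symm' hbe) (D.rel.symm' hac)

/-- The diagram whose links are the pairs `{x, f x}`. -/
def Diagram.ofInvolution (f : Fin n ⊕ Fin m → Fin n ⊕ Fin m) (hf : ∀ x, f (f x) = x)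
    (hne : ∀ x, f x ≠ x)
    (hpl : ∀ x y, bdryPos x < bdryPos y → bdryPos y < bdryPos (f x) →
      bdryPos (f x) < bdryPos (f y) → False) : Diagram n m where
  rel :=
    { r := fun x y => y = x ∨ y = f x
      iseqv := by
        refine ⟨fun x => Or.inl rfl, ?_, ?_⟩
        · rintro x y (rfl | rfl)
          · exact Or.inl rfl
          · exact Or.inr (hf x).symm
        · rintro x y z (rfl | rfl) (rfl | rfl)
          · exact Or.inl rfl
          · exact Or.inr rfl
          · exact Or.inr rfl
          · exact Or.inl (hf x) }
  pairing := by
    intro x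
    refine ⟨f x, ⟨hne x, Or.inr rfl⟩, ?_⟩
    rintro y ⟨h1, h2 | h2⟩
    · exact absurd h2 h1
    · exact h2
  planar := by
    rintro a b c e hab hbc hce (hac | hac) (hbe | hbe)
    · subst hac; omega
    · subst hac; omega
    · subst hbe; omega
    · subst hac hbe
      exact hpl a b hab hbc hce

/-- The identity diagram. -/
def Diagram.one (n : ℕ) : Diagram n n :=
  Diagram.ofInvolution Sum.swap Sum.swap_swap (by rintro (x | x) h <;> cases h) (by
    rintro (x | x) (y | y) h1 h2 h3 <;>
      simp only [bdryPos, Sum.swap_inl, Sum.swap_inr] at h1 h2 h3 <;> omega)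

theorem Diagram.one_rel (n : ℕ) : (Diagram.one n).rel = idRel (Fin n) := by
  ext x y
  change (y = x ∨ y = x.swap) ↔ Sum.elim id id x = Sum.elim id id y
  rcases x with x | x <;> rcases y with y | y <;> simp [eq_comm]

/-- The number of through lines, that is, of links joining the left side to the right side. -/
noncomputable def Diagram.throughLines (D : Diagram n m) : ℕ :=
  Set.ncard {i : Fin n | ∃ j : Fin m, D.rel (Sum.inl i) (Sum.inr j)}

/-- An `(n, m)`-diagram is monic if it has `m` through lines. -/
def Diagram.IsMonic (D : Diagram n m) : Prop := D.throughLines = m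

/-- The other end of the link at a point of the diagram `E_i` (with `0`-based `i`). -/
def cupCapPartner (n i : ℕ) (hi : i + 1 < n) : Fin n ⊕ Fin n → Fin n ⊕ Fin n
  | Sum.inl x => if x.1 = i then Sum.inl ⟨i + 1, hi⟩ else
      if x.1 = i + 1 then Sum.inl ⟨i, by omega⟩ else Sum.inr x
  | Sum.inr x => if x.1 = i then Sum.inr ⟨i + 1, hi⟩ else
      if x.1 = i + 1 then Sum.inr ⟨i, by omega⟩ else Sum.inl x

/-- The diagram which joins the points `i` and `i + 1` (numbered from `0`, from the top) on the
left side, joins the points `i` and `i + 1` on the right side, and is straight elsewhere. -/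
def Diagram.cupCap (n i : ℕ) (hi : i + 1 < n) : Diagram n n :=
  Diagram.ofInvolution (cupCapPartner n i hi)
    (by
      rintro (x | x) <;> simp only [cupCapPartner] <;> split_ifs with h1 h2 <;>
        simp [Fin.ext_iff, *])
    (by
      rintro (x | x) <;> simp only [cupCapPartner] <;> split_ifs with h1 h2 <;>
        simp [Fin.ext_iff, *])
    (by
      rintro (x | x) (y | y) <;> simp only [cupCapPartner] <;> split_ifs <;>
        simp only [bdryPos] <;> omega)

theorem Diagram.comp_assoc (D : Diagram n m) (E : Diagram m d) (F : Diagram d e) :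
    (D.comp E).comp F = D.comp (E.comp F) :=
  Diagram.ext (compRel_assoc D.rel E.rel F.rel)

theorem Diagram.one_comp (D : Diagram n m) : (Diagram.one n).comp D = D :=
  Diagram.ext ((congrArg (fun r => compRel r D.rel) (Diagram.one_rel n)).trans
    (compRel_id_left D.rel))

theorem Diagram.comp_one (D : Diagram n m) : D.comp (Diagram.one m) = D :=
  Diagram.ext ((congrArg (fun r => compRel D.rel r) (Diagram.one_rel m)).trans
    (compRel_id_right D.rel))

/-- Bilinear composition of formal linear combinations of diagrams: two diagrams are
concatenated, and each closed loop is replaced by a factor `β`. -/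
noncomputable def compLin (β : ℂ) (n m d : ℕ) :
    (Diagram n m →₀ ℂ) →ₗ[ℂ] (Diagram m d →₀ ℂ) →ₗ[ℂ] (Diagram n d →₀ ℂ) :=
  Finsupp.lift _ ℂ _ fun D => Finsupp.lift _ ℂ _ fun E =>
    Finsupp.single (D.comp E) (β ^ loops D.rel E.rel)

theorem compLin_single (β : ℂ) (D : Diagram n m) (E : Diagram m d) (a b : ℂ) :
    compLin β n m d (Finsupp.single D a) (Finsupp.single E b) =
      Finsupp.single (D.comp E) (a * b * β ^ loops D.rel E.rel) := by
  simp only [compLin, Finsupp.lift_apply, Finsupp.sum_single_index, zero_smul,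
    LinearMap.smul_apply, Finsupp.smul_single, smul_eq_mul]
  rw [Finsupp.sum_single_index (by simp), Finsupp.smul_single, smul_eq_mul, mul_assoc]

theorem compLin_assoc (β : ℂ) (u : Diagram n m →₀ ℂ) (v : Diagram m d →₀ ℂ)
    (w : Diagram d e →₀ ℂ) :
    compLin β n d e (compLin β n m d u v) w = compLin β n m e u (compLin β m d e v w) := by
  induction u using Finsupp.induction_linear with
  | zero => simp
  | add u u' hu hu' => simp only [map_add, LinearMap.add_apply, hu, hu']
  | single D a =>
    induction v using Finsupp.induction_linear with
    | zero => simp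
    | add v v' hv hv' => simp only [map_add, LinearMap.add_apply, hv, hv']
    | single E b =>
      induction w using Finsupp.induction_linear with
      | zero => simp
      | add w w' hw hw' => simp only [map_add, hw, hw']
      | single F c =>
        rw [compLin_single, compLin_single, compLin_single, compLin_single, Diagram.comp_assoc]
        congr 1
        have h := loops_assoc D.rel E.rel F.rel
        calc a * b * β ^ loops D.rel E.rel * c * β ^ loops (compRel D.rel E.rel) F.rel
            = a * b * c * β ^ (loops D.rel E.rel + loops (compRel D.rel E.rel) F.rel) := by
              rw [pow_add]; ring
          _ = a * (b * c * β ^ loops E.rel F.rel) * β ^ loops D.rel (compRel E.rel F.rel) := by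
              rw [h, pow_add]; ring

theorem one_compLin (β : ℂ) (v : Diagram n m →₀ ℂ) :
    compLin β n n m (Finsupp.single (Diagram.one n) 1) v = v := by
  induction v using Finsupp.induction_linear with
  | zero => simp
  | add v v' hv hv' => simp only [map_add, hv, hv']
  | single E b =>
    rw [compLin_single, Diagram.one_comp, Diagram.one_rel, loops_id_left]
    simp

theorem compLin_one (β : ℂ) (v : Diagram n m →₀ ℂ) :
    compLin β n m m v (Finsupp.single (Diagram.one m) 1) = v := by
  induction v using Finsupp.induction_linear with
  | zero => simp
  | add v v' hv hv' => simp only [map_add, LinearMap.add_apply, hv, hv']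
  | single E b =>
    rw [compLin_single, Diagram.comp_one, Diagram.one_rel, loops_id_right]
    simp

end Diagrams

/-- The Temperley-Lieb algebra `TL_n(β)`: formal linear combinations of `(n, n)`-diagrams. -/
def TL (n : ℕ) (_β : ℂ) : Type := Diagram n n →₀ ℂ

namespace TL

variable {n : ℕ} {β : ℂ}

noncomputable instance : AddCommGroup (TL n β) := inferInstanceAs (AddCommGroup (Diagram n n →₀ ℂ))

noncomputable instance : Module ℂ (TL n β) := inferInstanceAs (Module ℂ (Diagram n n →₀ ℂ))

/-- A diagram, as an element of the Temperley-Lieb algebra. -/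
noncomputable def ofDiagram (β : ℂ) (D : Diagram n n) : TL n β :=
  (Finsupp.single D 1 : Diagram n n →₀ ℂ)

noncomputable instance : Ring (TL n β) where
  mul x y := compLin β n n n x y
  one := ofDiagram β (Diagram.one n)
  left_distrib x y z := map_add (compLin β n n n x) y z
  right_distrib x y z := LinearMap.congr_fun (map_add (compLin β n n n) x y) z
  zero_mul x := LinearMap.congr_fun (map_zero (compLin β n n n)) x
  mul_zero x := map_zero (compLin β n n n x)
  mul_assoc x y z := compLin_assoc β x y z
  one_mul x := one_compLin β x
  mul_one x := compLin_one β x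
  neg_add_cancel x := neg_add_cancel x
  zsmul := fun k x => k • x
  zsmul_zero' := SubNegMonoid.zsmul_zero'
  zsmul_succ' := SubNegMonoid.zsmul_succ'
  zsmul_neg' := SubNegMonoid.zsmul_neg'
  nsmul := fun k x => k • x
  nsmul_zero := AddMonoid.nsmul_zero
  nsmul_succ := AddMonoid.nsmul_succ
  sub_eq_add_neg x y := sub_eq_add_neg x y

noncomputable instance : Algebra ℂ (TL n β) :=
  Algebra.ofModule
    (fun c x y => LinearMap.congr_fun (map_smul (compLin β n n n) c x) y)
    (fun c x y => map_smul (compLin β n n n x) c y)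

/-- The linear extension of the reflection of diagrams through a vertical mirror. -/
noncomputable def mirror (n : ℕ) (β : ℂ) : TL n β →ₗ[ℂ] TL n β :=
  (Finsupp.lmapDomain ℂ ℂ Diagram.flip : (Diagram n n →₀ ℂ) →ₗ[ℂ] (Diagram n n →₀ ℂ))

/-- The generator `E_i`, for `1 ≤ i < n` (and `0` for the other values of `i`, which are
never used). -/
noncomputable def E (n : ℕ) (β : ℂ) (i : ℕ) : TL n β :=
  if h : 1 ≤ i ∧ i < n then ofDiagram β (Diagram.cupCap n (i - 1) (by omega)) else 0

end TL
section Cellular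

/-- The span of the elements `C e p q` with `e < d`. -/
def lowerSpan (R : Type*) {A Λ : Type*} [CommRing R] [Ring A] [Algebra R A] [PartialOrder Λ]
    {M : Λ → Type*} (C : (d : Λ) → M d → M d → A) (d : Λ) : Submodule R A :=
  Submodule.span R {x | ∃ e : Λ, e < d ∧ ∃ p q : M e, x = C e p q}

/-- `(Λ, M, C, star)` is a cellular datum for the `R`-algebra `A` (Graham and Lehrer). -/
structure IsCellularDatum (R : Type*) {A Λ : Type*} [CommRing R] [Ring A] [Algebra R A]
    [PartialOrder Λ] {M : Λ → Type*} [∀ d, Fintype (M d)]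
    (C : (d : Λ) → M d → M d → A) (star : A →ₗ[R] A) : Prop where
  finite_poset : Finite Λ
  injective : Function.Injective (fun x : (d : Λ) × (M d × M d) => C x.1 x.2.1 x.2.2)
  linearIndependent : LinearIndependent R (fun x : (d : Λ) × (M d × M d) => C x.1 x.2.1 x.2.2)
  span_eq_top :
    Submodule.span R (Set.range fun x : (d : Λ) × (M d × M d) => C x.1 x.2.1 x.2.2) = ⊤
  star_star : ∀ a, star (star a) = a
  star_mul : ∀ a b, star (a * b) = star b * star a
  star_C : ∀ d s t, star (C d s t) = C d t s
  /-- the coefficients `r s' s` depend on `a` and `d`, but not on `t` -/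
  mul_C : ∀ (a : A) (d : Λ), ∃ r : M d → M d → R, ∀ s t : M d,
    a * C d s t - ∑ s' : M d, r s' s • C d s' t ∈ lowerSpan R C d

/-- An `R`-algebra is cellular if it admits a cellular datum. (The index sets are finite, so that
it is enough to consider index sets in the lowest universe.) -/
def IsCellular (R A : Type*) [CommRing R] [Ring A] [Algebra R A] : Prop :=
  ∃ (Λ : Type) (_ : PartialOrder Λ) (M : Λ → Type) (_ : ∀ d, Fintype (M d))
    (C : (d : Λ) → M d → M d → A) (star : A →ₗ[R] A), IsCellularDatum R C star

end Cellular

section TLDatum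

/-- The poset of the cellular datum of `TL_N`, ordered as a subset of `ℕ`. -/
abbrev TLIndex (N : ℕ) : Type := {d : ℕ // d ≤ N ∧ d ≡ N [MOD 2]}

/-- The monic `(N, d)`-diagrams. -/
abbrev TLMonic (N : ℕ) (d : TLIndex N) : Type := {s : Diagram N d.1 // s.IsMonic}

/-- `C^d(s, t)` is the concatenation of `s` with the mirror image of `t`. -/
noncomputable def TLCell (N : ℕ) (β : ℂ) (d : TLIndex N) (s t : TLMonic N d) : TL N β :=
  compLin β N d.1 N (Finsupp.single s.1 1) (Finsupp.single t.1.flip 1)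

end TLDatum

section Seam

/-- The `q`-number `[m] = (q ^ m - q ^ (-m)) / (q - q ^ (-1))`. -/
noncomputable def qNumber (q : ℂ) (m : ℕ) : ℂ := (q ^ m - q⁻¹ ^ m) / (q - q⁻¹)

/-- The Wenzl-Jones projector `P_k` in `TL_N(q + q⁻¹)`, which acts on the bottom `k` points:
`P_1 = 1` and `P_k = P_{k-1} - ([k-1] / [k]) P_{k-1} E_{N-k+1} P_{k-1}` for `1 < k ≤ N`. -/
noncomputable def wenzlJones (q : ℂ) (N : ℕ) : ℕ → TL N (q + q⁻¹)
  | 0 => 1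
  | 1 => 1
  | j + 2 => wenzlJones q N (j + 1) - (qNumber q (j + 1) / qNumber q (j + 2)) •
      (wenzlJones q N (j + 1) * TL.E N (q + q⁻¹) (N - (j + 2) + 1) * wenzlJones q N (j + 1))

/-- The corner `e A e` of an `R`-algebra `A` is an `R`-algebra, with identity `e`. -/
noncomputable instance cornerModule {R A : Type*} [CommRing R] [Ring A] [Algebra R A] {e : A}
    (he : IsIdempotentElem e) : Module R he.Corner where
  smul c x := ⟨c • x.1, by
    obtain ⟨a, ha⟩ := x.2
    exact ⟨c • a, by rw [← ha]; simp only [mul_smul_comm, smul_mul_assoc]⟩⟩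
  one_smul x := Subtype.ext (one_smul R x.1)
  mul_smul a b x := Subtype.ext (mul_smul a b x.1)
  smul_zero a := Subtype.ext (smul_zero a)
  smul_add a x y := Subtype.ext (smul_add a x.1 y.1)
  add_smul a b x := Subtype.ext (add_smul a b x.1)
  zero_smul x := Subtype.ext (zero_smul R x.1)

noncomputable instance cornerAlgebra {R A : Type*} [CommRing R] [Ring A] [Algebra R A] {e : A}
    (he : IsIdempotentElem e) : Algebra R he.Corner :=
  Algebra.ofModule (fun c x y => Subtype.ext (smul_mul_assoc c x.1 y.1))
    (fun c x y => Subtype.ext (mul_smul_comm c x.1 y.1))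

/-- The boundary seam algebra `B_{n,k} = P_k TL_{n+k} P_k`, with identity `P_k`. -/
abbrev SeamAlgebra (n k : ℕ) (q : ℂ) (hP : IsIdempotentElem (wenzlJones q (n + k) k)) : Type :=
  hP.Corner

/-- The set `N(d)` of the monic diagrams `s` such that `P_k C^d(s, t) P_k` vanishes modulo lower
terms of the Temperley-Lieb algebra, for all `t`. -/
def seamNull (n k : ℕ) (q : ℂ) (d : TLIndex (n + k)) : Set (TLMonic (n + k) d) :=
  {s | ∀ t, wenzlJones q (n + k) k * TLCell (n + k) (q + q⁻¹) d s t * wenzlJones q (n + k) k ∈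
    lowerSpan ℂ (TLCell (n + k) (q + q⁻¹)) d}

/-- The poset of the cellular datum of the seam algebra. -/
abbrev SeamIndex (n k : ℕ) (q : ℂ) : Type :=
  {d : TLIndex (n + k) // seamNull n k q d ≠ Set.univ}

/-- The index sets `M(d)` of the cellular datum of the seam algebra. -/
abbrev SeamMonic (n k : ℕ) (q : ℂ) (d : SeamIndex n k q) : Type :=
  {s : TLMonic (n + k) d.1 // s ∉ seamNull n k q d.1}

noncomputable instance (n k : ℕ) (q : ℂ) (d : SeamIndex n k q) : Fintype (SeamMonic n k q d) :=
  Fintype.ofFinite _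

/-- The map `C` of the cellular datum of the seam algebra: `C^d(s, t) = P_k (s t^*) P_k`. -/
noncomputable def seamCell (n k : ℕ) (q : ℂ)
    (hP : IsIdempotentElem (wenzlJones q (n + k) k)) (d : SeamIndex n k q)
    (s t : SeamMonic n k q d) : SeamAlgebra n k q hP :=
  ⟨wenzlJones q (n + k) k * TLCell (n + k) (q + q⁻¹) d.1 s.1 t.1 * wenzlJones q (n + k) k,
    ⟨TLCell (n + k) (q + q⁻¹) d.1 s.1 t.1, rfl⟩⟩

end Seam

end TemperleyLieb

/-! Write P for `wenzlJones q (n + k) k`. Call a link between two of the bottom k points on the left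
side of a diagram a bottom link. Everything rests on how P treats diagrams with such links.

P kills them: by planarity a bottom link encloses one that joins neighbours a and a+1
(`Diagram.BottomLink.exists_adjacent`), so the diagram D satisfies E D = β D for the corresponding
generator E. Since P E = 0 (`wenzlJones_spec`) and β ≠ 0, also P D = 0 (`wenzlJones_mul_ofDiagram`).
The mirror image gives D P = 0 for links on the right side.

P does nothing else: expanding the recursion shows that P - 1 is a combination of diagrams with a
bottom link (`wenzlJones_sub_one_mem`). Hence P x P and x have the same coefficient at every diagram
without a bottom link on either side (`wenzlJones_mul_mul_sub_mem`).

Every (N,N)-diagram is s t^* for unique monic s and t, obtained by cutting its through lines; s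
carries the left links and t the right ones. Therefore P C(s,t) P = 0 as soon as s or t has a bottom
link, and otherwise its coefficient at s t^* is 1. So N(d) consists exactly of the monic diagrams
with a bottom link (`mem_seamNull_iff`), and the compressed cells that remain form a basis: they
span because P x P runs over the corner, and the coefficient functionals are dual to them.
Multiplication cannot raise the number of through lines, which gives the cellular congruence in TL
(`TLCell_mul`). Compressing that congruence, with the null terms dropping out, gives the one for the
corner (`seamCell_mul`).

The index set is a count: without a bottom link the k bottom points are linked to distinct points
among the n + d others, so k ≤ n + d; nested arcs at the top show that this suffices
(`range_seamIndex`). -/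

namespace TemperleyLieb

/-! ### Pairings and their partners. -/

section PairingLemmas

variable {V : Type*}

/-- A pairing is determined by its partner function, so one common link at each point is enough.
Most equalities of diagrams below are proved this way, which avoids an analysis of all connections
in a concatenation. -/
theorem IsPairing.eq_of_common {r s : Setoid V} (hr : IsPairing r) (hs : IsPairing s)
    (h : ∀ x, ∃ y, y ≠ x ∧ r x y ∧ s x y) : r = s := by
  have hp : ∀ x, hr.partner x = hs.partner x := by
    intro x
    obtain ⟨y, h1, h2, h3⟩ := h x
    rw [← hr.eq_partner h1 h2, ← hs.eq_partner h1 h3]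
  ext x y
  rw [hr.rel_iff, hs.rel_iff, hp]

theorem IsPairing.eq_of_rel {r : Setoid V} (h : IsPairing r) {x y z : V} (hy : y ≠ x)
    (hz : z ≠ x) (hxy : r x y) (hxz : r x z) : y = z :=
  (h.eq_partner hy hxy).trans (h.eq_partner hz hxz).symm

end PairingLemmas

/-! ### Links, loops and mirror images of concatenations. -/

section ConcatLemmas

variable {X Y Z : Type*} {r : Setoid (X ⊕ Y)} {s : Setoid (Y ⊕ Z)}

theorem concat_left {u v : X ⊕ Y} (h : r u v) : concat r s (inLeft u) (inLeft v) :=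
  (le_sup_left : _ ≤ concat r s) (map_rel r inLeft h)

theorem concat_right {u v : Y ⊕ Z} (h : s u v) : concat r s (inRight u) (inRight v) :=
  (le_sup_right : _ ≤ concat r s) (map_rel s inRight h)

theorem compRel_left {x x' : X} (h : r (Sum.inl x) (Sum.inl x')) :
    compRel r s (Sum.inl x) (Sum.inl x') :=
  concat_left (s := s) h

theorem compRel_right {z z' : Z} (h : s (Sum.inr z) (Sum.inr z')) :
    compRel r s (Sum.inr z) (Sum.inr z') :=
  concat_right (r := r) h

theorem compRel_through {x : X} {y : Y} {z : Z} (h : r (Sum.inl x) (Sum.inr y))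
    (h' : s (Sum.inl y) (Sum.inr z)) : compRel r s (Sum.inl x) (Sum.inr z) :=
  Setoid.trans' (concat r s) (concat_left (s := s) h) (concat_right (r := r) h')

/-- A closed loop is a class made of middle points only, and a connection to an outer point rules
this out. -/
theorem loops_eq_zero [Finite X] [Finite Y] [Finite Z]
    (h : ∀ y : Y, ∃ o : X ⊕ Z, concat r s (Sum.inr (Sum.inl y)) (inOuter o)) :
    loops r s = 0 := by
  unfold loops
  rw [Set.ncard_eq_zero, Set.eq_empty_iff_forall_notMem]
  rintro c ⟨hc, hm⟩
  obtain ⟨v, hv⟩ := mem_classes_nonempty hc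
  obtain ⟨y, rfl⟩ := hm hv
  obtain ⟨o, ho⟩ := h y
  rw [mem_classes_eq hc hv] at hm
  obtain ⟨y', hy'⟩ := hm (Setoid.symm' _ ho)
  rcases o with o | o <;> cases hy'

theorem loops_eq_zero_of_left [Finite X] [Finite Y] [Finite Z]
    (h : ∀ y : Y, ∃ x : X, r (Sum.inl x) (Sum.inr y)) : loops r s = 0 := by
  refine loops_eq_zero fun y => ?_
  obtain ⟨x, hx⟩ := h y
  exact ⟨Sum.inl x, concat_left (r.symm' hx)⟩

/-- The points of a concatenation, seen in the mirror. -/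
def mirrorPoint : Z ⊕ (Y ⊕ X) → X ⊕ (Y ⊕ Z) :=
  Sum.elim (Sum.inr ∘ Sum.inr) (Sum.elim (Sum.inr ∘ Sum.inl) Sum.inl)

theorem concat_flip_le (r : Setoid (X ⊕ Y)) (s : Setoid (Y ⊕ Z)) :
    concat (flipRel s) (flipRel r) ≤ (concat r s).comap mirrorPoint := by
  refine sup_le ((map_le_iff _ _ _).2 ?_) ((map_le_iff _ _ _).2 ?_)
  · rintro (x | x) (y | y) h <;> exact concat_right (r := r) (s := s) h
  · rintro (x | x) (y | y) h <;> exact concat_left (r := r) (s := s) h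

theorem mirrorPoint_mirrorPoint (v : X ⊕ (Y ⊕ Z)) : mirrorPoint (mirrorPoint v) = v := by
  rcases v with v | v | v <;> rfl

theorem flipRel_flipRel (r : Setoid (X ⊕ Y)) : flipRel (flipRel r) = r := by
  ext x y
  change r x.swap.swap y.swap.swap ↔ _
  rw [Sum.swap_swap, Sum.swap_swap]

theorem concat_flip (r : Setoid (X ⊕ Y)) (s : Setoid (Y ⊕ Z)) :
    concat (flipRel s) (flipRel r) = (concat r s).comap mirrorPoint := by
  refine le_antisymm (concat_flip_le r s) fun {v w} h => ?_
  -- Mirroring is an involution, so the same inequality for the mirrored pair is the reverse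
  -- inequality.
  have h' := concat_flip_le (flipRel s) (flipRel r)
  rw [flipRel_flipRel, flipRel_flipRel] at h'
  have := h' h
  rwa [Setoid.comap_rel, mirrorPoint_mirrorPoint, mirrorPoint_mirrorPoint] at this

theorem compRel_flip (r : Setoid (X ⊕ Y)) (s : Setoid (Y ⊕ Z)) :
    compRel (flipRel s) (flipRel r) = flipRel (compRel r s) := by
  unfold compRel
  rw [concat_flip]
  ext (v | v) (w | w) <;> rfl

/-- `mirrorPoint` is a bijection that preserves the middle points. Thus in `classesIn_comap` the
term for classes outside its range is zero. -/
theorem loops_flip [Finite X] [Finite Y] [Finite Z] (r : Setoid (X ⊕ Y)) (s : Setoid (Y ⊕ Z)) :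
    loops (flipRel s) (flipRel r) = loops r s := by
  have hr : (Set.range (mirrorPoint : Z ⊕ (Y ⊕ X) → X ⊕ (Y ⊕ Z)))ᶜ = ∅ :=
    Set.compl_empty_iff.2 (Set.range_eq_univ.2 fun v => ⟨_, mirrorPoint_mirrorPoint v⟩)
  have h := classesIn_comap (mirrorPoint : Z ⊕ (Y ⊕ X) → X ⊕ (Y ⊕ Z)) (concat r s) middle
    (by rw [hr]; exact Set.empty_subset _)
  have h0 : classesIn (concat r s) ∅ = 0 := by
    unfold classesIn
    rw [Set.ncard_eq_zero, Set.eq_empty_iff_forall_notMem]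
    rintro c ⟨hc, hm⟩
    obtain ⟨v, hv⟩ := mem_classes_nonempty hc
    exact hm hv
  have hm : (mirrorPoint : Z ⊕ (Y ⊕ X) → X ⊕ (Y ⊕ Z)) ⁻¹' middle = middle := by
    ext (v | v | v) <;> simp [mirrorPoint, middle]
  rw [hr, h0, hm, add_zero, ← concat_flip] at h
  exact h.symm

end ConcatLemmas

/-! ### Temperley-Lieb relations at the level of diagrams. -/

section CupCap

variable {n m : ℕ}

/-- `D` joins `a` and `b` on both sides and is straight elsewhere. -/
structure Diagram.IsCupCap (D : Diagram n n) (a b : Fin n) : Prop where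
  ne : a ≠ b
  left : D.rel (Sum.inl a) (Sum.inl b)
  right : D.rel (Sum.inr a) (Sum.inr b)
  straight : ∀ x, x ≠ a → x ≠ b → D.rel (Sum.inl x) (Sum.inr x)

theorem Diagram.IsCupCap.symm {D : Diagram n n} {a b : Fin n} (h : D.IsCupCap a b) :
    D.IsCupCap b a :=
  ⟨h.ne.symm, D.rel.symm' h.left, D.rel.symm' h.right, fun x h1 h2 => h.straight x h2 h1⟩

theorem Diagram.isCupCap_cupCap (i : ℕ) (hi : i + 1 < n) :
    (Diagram.cupCap n i hi).IsCupCap ⟨i, by omega⟩ ⟨i + 1, hi⟩ where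
  ne := by simp
  left := Or.inr (by simp [cupCapPartner])
  right := Or.inr (by simp [cupCapPartner])
  straight x h1 h2 := Or.inr (by
    have h1' : x.1 ≠ i := fun h => h1 (Fin.ext h)
    have h2' : x.1 ≠ i + 1 := fun h => h2 (Fin.ext h)
    simp [cupCapPartner, h1', h2'])

/-- The links named in `IsCupCap` cover all boundary points. -/
theorem Diagram.IsCupCap.eq {D D' : Diagram n n} {a b : Fin n} (h : D.IsCupCap a b)
    (h' : D'.IsCupCap a b) : D = D' := by
  refine Diagram.ext (D.pairing.eq_of_common D'.pairing ?_)
  rintro (x | x)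
  · by_cases h1 : x = a
    · subst h1; exact ⟨Sum.inl b, by simpa using h.ne.symm, h.left, h'.left⟩
    by_cases h2 : x = b
    · subst h2; exact ⟨Sum.inl a, by simpa using h.ne, h.symm.left, h'.symm.left⟩
    exact ⟨Sum.inr x, by simp, h.straight x h1 h2, h'.straight x h1 h2⟩
  · by_cases h1 : x = a
    · subst h1; exact ⟨Sum.inr b, by simpa using h.ne.symm, h.right, h'.right⟩
    by_cases h2 : x = b
    · subst h2; exact ⟨Sum.inr a, by simpa using h.ne, h.symm.right, h'.symm.right⟩
    exact ⟨Sum.inl x, by simp, D.rel.symm' (h.straight x h1 h2),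
      D'.rel.symm' (h'.straight x h1 h2)⟩

theorem Diagram.IsCupCap.flip {D : Diagram n n} {a b : Fin n} (h : D.IsCupCap a b) :
    D.flip.IsCupCap a b :=
  ⟨h.ne, h.right, h.left, fun x h1 h2 => D.rel.symm' (h.straight x h1 h2)⟩

theorem Diagram.IsCupCap.flip_eq {D : Diagram n n} {a b : Fin n} (h : D.IsCupCap a b) :
    D.flip = D :=
  h.flip.eq h

/-- The link of `F` between `a` and `b` is absorbed into a closed loop and replaced by the equal
link on the left of `D`; every other strand of `F` is only lengthened by straight lines. -/
theorem Diagram.IsCupCap.comp_eq {D : Diagram n n} {a b : Fin n} (h : D.IsCupCap a b)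
    {F : Diagram n m} (hF : F.rel (Sum.inl a) (Sum.inl b)) : D.comp F = F := by
  have h0 : ∀ x : Fin n ⊕ Fin m, x ≠ Sum.inl a → x ≠ Sum.inl b →
      concat D.rel F.rel (inOuter x) (inRight x) := by
    rintro (x | x) h1 h2
    · exact concat_left (h.straight x (fun e => h1 (by rw [e])) (fun e => h2 (by rw [e])))
    · exact Setoid.refl' _ _
  refine Diagram.ext ((D.comp F).pairing.eq_of_common F.pairing fun x => ?_)
  have hab : (Sum.inl a : Fin n ⊕ Fin m) ≠ Sum.inl b := by simpa using h.ne
  by_cases h1 : x = Sum.inl a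
  · subst h1
    exact ⟨Sum.inl b, hab.symm, compRel_left h.left, hF⟩
  by_cases h2 : x = Sum.inl b
  · subst h2
    exact ⟨Sum.inl a, hab, compRel_left h.symm.left, F.rel.symm' hF⟩
  refine ⟨F.pairing.partner x, F.pairing.partner_ne x, ?_, F.pairing.rel_partner x⟩
  have hx := F.pairing.rel_partner x
  -- The points `a` and `b` are partners of each other, hence of nothing else.
  have h3 : F.pairing.partner x ≠ Sum.inl a := fun e => by
    rw [e] at hx
    exact h2 (F.pairing.eq_of_rel h1 hab.symm (F.rel.symm' hx) hF)
  have h4 : F.pairing.partner x ≠ Sum.inl b := fun e => by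
    rw [e] at hx
    exact h1 (F.pairing.eq_of_rel h2 hab (F.rel.symm' hx) (F.rel.symm' hF))
  exact Setoid.trans' (concat D.rel F.rel) (h0 x h1 h2) (Setoid.trans' _ (concat_right hx)
    (Setoid.symm' _ (h0 _ h3 h4)))

/-- The pair is a full class of the pairing, so membership in it is constant along links. -/
theorem IsPairing.mem_pair_iff {V : Type*} {r : Setoid V} (h : IsPairing r) {a b : V}
    (hab : a ≠ b) (hr : r a b) {x y : V} (hxy : r x y) :
    (x = a ∨ x = b) ↔ (y = a ∨ y = b) := by
  have key : ∀ {x y}, r x y → (x = a ∨ x = b) → (y = a ∨ y = b) := by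
    rintro x y hxy (rfl | rfl)
    · by_cases hy : y = x
      · exact Or.inl hy
      · exact Or.inr (h.eq_of_rel hy hab.symm hxy hr)
    · by_cases hy : y = x
      · exact Or.inr hy
      · exact Or.inl (h.eq_of_rel hy hab hxy (r.symm' hr))
  exact ⟨key hxy, key (r.symm' hxy)⟩

/-- The right link of `D` and the link of `F` close up to one loop. Any other middle point runs
straight to the left side, so it lies on no loop. -/
theorem Diagram.IsCupCap.loops_eq_one {D : Diagram n n} {a b : Fin n} (h : D.IsCupCap a b)
    {F : Diagram n m} (hF : F.rel (Sum.inl a) (Sum.inl b)) : loops D.rel F.rel = 1 := by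
  unfold loops
  rw [Set.ncard_eq_one]
  have hab : concat D.rel F.rel (Sum.inr (Sum.inl a)) (Sum.inr (Sum.inl b)) := concat_right hF
  refine ⟨{v | concat D.rel F.rel v (Sum.inr (Sum.inl a))}, Set.eq_singleton_iff_unique_mem.2
    ⟨⟨⟨_, rfl⟩, ?_⟩, ?_⟩⟩
  -- Being one of the two middle points `a`, `b` is invariant along the links of both boxes; hence
  -- the class of `a` contains no further point.
  · have hle : concat D.rel F.rel ≤ Setoid.ker (fun v : Fin n ⊕ (Fin n ⊕ Fin m) =>
        v = Sum.inr (Sum.inl a) ∨ v = Sum.inr (Sum.inl b)) := by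
      refine sup_le ((map_le_iff _ _ _).2 ?_) ((map_le_iff _ _ _).2 ?_)
      · intro x y hxy
        have := D.pairing.mem_pair_iff (Sum.inr_injective.ne h.ne) h.right hxy
        refine propext ?_
        rcases x with x | x <;> rcases y with y | y <;> simpa [inLeft] using this
      · intro x y hxy
        have := F.pairing.mem_pair_iff (Sum.inl_injective.ne h.ne) hF hxy
        refine propext ?_
        simpa [inRight] using this
    intro v hv
    have : (_ ∨ _) = (_ ∨ _) := hle hv
    rcases this.mpr (Or.inl rfl) with rfl | rfl
    · exact ⟨a, rfl⟩
    · exact ⟨b, rfl⟩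
  · rintro c ⟨hc, hm⟩
    obtain ⟨v, hv⟩ := mem_classes_nonempty hc
    obtain ⟨x, rfl⟩ := hm hv
    have hmem : Sum.inr (Sum.inl a) ∈ c := by
      have hcx := mem_classes_eq hc hv
      by_cases h1 : x = a
      · rw [← h1]; exact hv
      by_cases h2 : x = b
      · rw [hcx, h2]; exact hab
      exfalso
      have : (Sum.inl x : Fin n ⊕ (Fin n ⊕ Fin m)) ∈ c := by
        rw [hcx]
        exact concat_left (h.straight x h1 h2)
      obtain ⟨y, hy⟩ := hm this
      cases hy
    exact mem_classes_eq hc hmem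

/-- Both products join `a` to `b` and `c` to `d` on each side and are straight elsewhere. The
auxiliary `key` finds the four short links for either order of the factors. -/
theorem Diagram.IsCupCap.comp_comm {D F : Diagram n n} {a b c d : Fin n} (h : D.IsCupCap a b)
    (h' : F.IsCupCap c d) (hac : a ≠ c) (had : a ≠ d) (hbc : b ≠ c) (hbd : b ≠ d) :
    D.comp F = F.comp D := by
  have key : ∀ {D F : Diagram n n} {a b c d : Fin n}, D.IsCupCap a b → F.IsCupCap c d →
      a ≠ c → a ≠ d → b ≠ c → b ≠ d →
      (D.comp F).rel (Sum.inl a) (Sum.inl b) ∧ (D.comp F).rel (Sum.inl c) (Sum.inl d) ∧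
      (D.comp F).rel (Sum.inr a) (Sum.inr b) ∧ (D.comp F).rel (Sum.inr c) (Sum.inr d) := by
    intro D F a b c d h h' hac had hbc hbd
    refine ⟨compRel_left h.left, ?_, ?_, compRel_right h'.right⟩
    · exact Setoid.trans' (concat D.rel F.rel)
        (concat_left (h.straight c hac.symm hbc.symm)) (Setoid.trans' (concat D.rel F.rel)
        (concat_right h'.left) (Setoid.symm' (concat D.rel F.rel)
        (concat_left (h.straight d had.symm hbd.symm))))
    · exact Setoid.trans' (concat D.rel F.rel) (Setoid.symm' (concat D.rel F.rel)
        (concat_right (h'.straight a hac had))) (Setoid.trans' (concat D.rel F.rel)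
        (concat_left h.right) (concat_right (h'.straight b hbc hbd)))
  obtain ⟨k1, k2, k3, k4⟩ := key h h' hac had hbc hbd
  obtain ⟨l1, l2, l3, l4⟩ := key h' h hac.symm hbc.symm had.symm hbd.symm
  have hs : ∀ x, x ≠ a → x ≠ b → x ≠ c → x ≠ d →
      (D.comp F).rel (Sum.inl x) (Sum.inr x) ∧ (F.comp D).rel (Sum.inl x) (Sum.inr x) :=
    fun x h1 h2 h3 h4 => ⟨compRel_through (h.straight x h1 h2) (h'.straight x h3 h4),
      compRel_through (h'.straight x h3 h4) (h.straight x h1 h2)⟩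
  refine Diagram.ext ((D.comp F).pairing.eq_of_common (F.comp D).pairing ?_)
  rintro (x | x)
  · by_cases h1 : x = a
    · subst h1; exact ⟨Sum.inl b, by simpa using h.ne.symm, k1, l2⟩
    by_cases h2 : x = b
    · subst h2; exact ⟨Sum.inl a, by simpa using h.ne, Setoid.symm' _ k1, Setoid.symm' _ l2⟩
    by_cases h3 : x = c
    · subst h3; exact ⟨Sum.inl d, by simpa using h'.ne.symm, k2, l1⟩
    by_cases h4 : x = d
    · subst h4; exact ⟨Sum.inl c, by simpa using h'.ne, Setoid.symm' _ k2, Setoid.symm' _ l1⟩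
    exact ⟨Sum.inr x, by simp, hs x h1 h2 h3 h4⟩
  · by_cases h1 : x = a
    · subst h1; exact ⟨Sum.inr b, by simpa using h.ne.symm, k3, l4⟩
    by_cases h2 : x = b
    · subst h2; exact ⟨Sum.inr a, by simpa using h.ne, Setoid.symm' _ k3, Setoid.symm' _ l4⟩
    by_cases h3 : x = c
    · subst h3; exact ⟨Sum.inr d, by simpa using h'.ne.symm, k4, l3⟩
    by_cases h4 : x = d
    · subst h4; exact ⟨Sum.inr c, by simpa using h'.ne, Setoid.symm' _ k4, Setoid.symm' _ l3⟩
    exact ⟨Sum.inl x, by simp, Setoid.symm' _ (hs x h1 h2 h3 h4).1,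
      Setoid.symm' _ (hs x h1 h2 h3 h4).2⟩

theorem Diagram.IsCupCap.loops_eq_zero_of_disjoint {D F : Diagram n n} {a b c d : Fin n}
    (h : D.IsCupCap a b) (h' : F.IsCupCap c d) (hac : a ≠ c) (had : a ≠ d) (hbc : b ≠ c)
    (hbd : b ≠ d) : loops D.rel F.rel = 0 := by
  refine loops_eq_zero fun x => ?_
  by_cases h1 : x = a
  · subst h1; exact ⟨Sum.inr x, concat_right (h'.straight x hac had)⟩
  by_cases h2 : x = b
  · subst h2; exact ⟨Sum.inr x, concat_right (h'.straight x hbc hbd)⟩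
  exact ⟨Sum.inl x, concat_left (D.rel.symm' (h.straight x h1 h2))⟩

section Adjacent

variable {D F : Diagram n n} {a b c : Fin n}

/-- The middle points `a` and `b` escape to the right through the straight line of `F` at `a`; all
others escape to the left. -/
theorem Diagram.IsCupCap.loops_adjacent (h : D.IsCupCap a b) (h' : F.IsCupCap b c)
    (hac : a ≠ c) : loops D.rel F.rel = 0 := by
  have ha : concat D.rel F.rel (Sum.inr (Sum.inl a)) (inOuter (Sum.inr a)) :=
    concat_right (h'.straight a h.ne hac)
  refine loops_eq_zero fun x => ?_
  by_cases h1 : x = a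
  · subst h1; exact ⟨_, ha⟩
  by_cases h2 : x = b
  · subst h2
    exact ⟨_, Setoid.trans' _ (concat_left h.symm.right) ha⟩
  exact ⟨Sum.inl x, concat_left (D.rel.symm' (h.straight x h1 h2))⟩

theorem Diagram.IsCupCap.comp_rel_adjacent (h : D.IsCupCap a b) (h' : F.IsCupCap b c)
    (hac : a ≠ c) : (D.comp F).rel (Sum.inl c) (Sum.inr a) :=
  Setoid.trans' (concat D.rel F.rel) (concat_left (h.straight c hac.symm h'.ne.symm))
    (Setoid.trans' _ (concat_right h'.symm.left)
    (Setoid.trans' _ (concat_left h.symm.right) (concat_right (h'.straight a h.ne hac))))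

theorem Diagram.IsCupCap.comp_straight_adjacent (h : D.IsCupCap a b) (h' : F.IsCupCap b c)
    {x : Fin n} (h1 : x ≠ a) (h2 : x ≠ b) (h3 : x ≠ c) :
    (D.comp F).rel (Sum.inl x) (Sum.inr x) :=
  compRel_through (h.straight x h1 h2) (h'.straight x h2 h3)

theorem Diagram.IsCupCap.loops_adjacent' (h : D.IsCupCap a b) (h' : F.IsCupCap b c)
    (hac : a ≠ c) : loops (D.comp F).rel D.rel = 0 := by
  have ha : concat (D.comp F).rel D.rel (Sum.inr (Sum.inl a)) (inOuter (Sum.inl c)) :=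
    concat_left (Setoid.symm' _ (h.comp_rel_adjacent h' hac))
  refine loops_eq_zero fun x => ?_
  by_cases h1 : x = a
  · subst h1; exact ⟨_, ha⟩
  by_cases h2 : x = b
  · subst h2
    exact ⟨_, Setoid.trans' _ (concat_right h.symm.left) ha⟩
  exact ⟨Sum.inr x, concat_right (h.straight x h1 h2)⟩

theorem Diagram.IsCupCap.comp_comp_adjacent (h : D.IsCupCap a b) (h' : F.IsCupCap b c)
    (hac : a ≠ c) : (D.comp F).comp D = D := by
  refine Diagram.IsCupCap.eq (a := a) (b := b) ⟨h.ne, ?_, ?_, fun x h1 h2 => ?_⟩ h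
  · exact compRel_left (r := (D.comp F).rel) (compRel_left (r := D.rel) h.left)
  · exact compRel_right h.right
  · by_cases h3 : x = c
    · subst h3
      -- The zigzag at `c`: through `D F` from `c` to `a`, back along the left link of the last `D`
      -- to `b`, along the right link of `F` to `c`, and straight out.
      exact Setoid.trans' (concat (D.comp F).rel D.rel)
        (concat_left (h.comp_rel_adjacent h' hac)) (Setoid.trans' _ (concat_right h.left)
        (Setoid.trans' _ (concat_left (compRel_right (r := D.rel) h'.right))
        (concat_right (h.straight x h1 h2))))
    · exact compRel_through (h.comp_straight_adjacent h' h1 h2 h3) (h.straight x h1 h2)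

end Adjacent

end CupCap
-- Cutting diagrams along their through lines.
section Factorization

variable {n m d N : ℕ}

theorem Diagram.flip_flip (D : Diagram n m) : D.flip.flip = D :=
  Diagram.ext (flipRel_flipRel D.rel)

theorem Diagram.comp_flip (D : Diagram n m) (F : Diagram m d) :
    (D.comp F).flip = F.flip.comp D.flip :=
  Diagram.ext (compRel_flip D.rel F.rel).symm

/-- The left ends of the through lines. -/
def Diagram.throughLeft (D : Diagram n m) : Set (Fin n) :=
  {i | ∃ j, D.rel (Sum.inl i) (Sum.inr j)}

/-- This makes the set of through ends on one side a function of the links within that side alone.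
-/
theorem Diagram.mem_throughLeft_iff (D : Diagram n m) (i : Fin n) :
    i ∈ D.throughLeft ↔ ∀ i', D.rel (Sum.inl i) (Sum.inl i') → i' = i := by
  constructor
  · rintro ⟨j, hj⟩ i' hi'
    by_contra hne
    have := D.pairing.eq_of_rel (by simp) (Sum.inl_injective.ne hne) hj hi'
    cases this
  · intro h
    have h1 := D.pairing.partner_ne (Sum.inl i)
    have h2 := D.pairing.rel_partner (Sum.inl i)
    rcases h3 : D.pairing.partner (Sum.inl i) with i' | j
    · rw [h3] at h1 h2
      exact absurd (congrArg Sum.inl (h i' h2)) h1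
    · rw [h3] at h2
      exact ⟨j, h2⟩

theorem Diagram.rel_inr_unique (D : Diagram n m) {i : Fin n} {j j' : Fin m}
    (h : D.rel (Sum.inl i) (Sum.inr j)) (h' : D.rel (Sum.inl i) (Sum.inr j')) : j = j' :=
  Sum.inr_injective (D.pairing.eq_of_rel (by simp) (by simp) h h')

theorem Diagram.rel_inl_unique (D : Diagram n m) {i i' : Fin n} {j : Fin m}
    (h : D.rel (Sum.inl i) (Sum.inr j)) (h' : D.rel (Sum.inl i') (Sum.inr j)) : i = i' :=
  D.flip.rel_inr_unique (i := j) (D.rel.symm' h) (D.rel.symm' h')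

/-- `bdryPos` runs down the left side and up the right side, so two through lines avoid crossing
only if their ends have the same vertical order. -/
theorem Diagram.lt_of_through (D : Diagram n m) {i i' : Fin n} {j j' : Fin m} (hi : i < i')
    (h : D.rel (Sum.inl i) (Sum.inr j)) (h' : D.rel (Sum.inl i') (Sum.inr j')) : j < j' := by
  by_contra hj
  rcases (not_lt.1 hj).lt_or_eq with hlt | rfl
  · refine D.planar (Sum.inl i) (Sum.inl i') (Sum.inr j) (Sum.inr j') hi ?_ ?_ h h' <;>
      simp only [bdryPos] <;> omega
  · exact hi.ne (D.rel_inl_unique h h')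

/-- The right end of the through line with left end `i`. -/
noncomputable def Diagram.throughMap (D : Diagram n m) (i : D.throughLeft) : Fin m :=
  i.2.choose

theorem Diagram.rel_throughMap (D : Diagram n m) (i : D.throughLeft) :
    D.rel (Sum.inl i.1) (Sum.inr (D.throughMap i)) :=
  i.2.choose_spec

theorem Diagram.throughMap_strictMono (D : Diagram n m) : StrictMono D.throughMap :=
  fun i i' h => D.lt_of_through h (D.rel_throughMap i) (D.rel_throughMap i')

theorem Diagram.range_throughMap (D : Diagram n m) :
    Set.range D.throughMap = D.flip.throughLeft := by
  ext j
  constructor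
  · rintro ⟨i, rfl⟩
    exact ⟨i.1, D.rel.symm' (D.rel_throughMap i)⟩
  · rintro ⟨i, hi⟩
    have hi' : D.rel (Sum.inl i) (Sum.inr j) := D.rel.symm' hi
    exact ⟨⟨i, j, hi'⟩, D.rel_inr_unique (D.rel_throughMap _) hi'⟩

/-- A diagram is determined by its links between points on the same side. -/
theorem Diagram.eq_of_left_right {D D' : Diagram n m}
    (hl : ∀ i i', D.rel (Sum.inl i) (Sum.inl i') ↔ D'.rel (Sum.inl i) (Sum.inl i'))
    (hr : ∀ j j', D.rel (Sum.inr j) (Sum.inr j') ↔ D'.rel (Sum.inr j) (Sum.inr j')) :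
    D = D' := by
  have hL : D.throughLeft = D'.throughLeft := by
    ext i
    simp only [Diagram.mem_throughLeft_iff, hl]
  have hR : D.flip.throughLeft = D'.flip.throughLeft := by
    ext j
    simp only [Diagram.mem_throughLeft_iff]
    exact forall_congr' fun j' => imp_congr (hr j j') Iff.rfl
  have hthrough : ∀ i j, D.rel (Sum.inl i) (Sum.inr j) → D'.rel (Sum.inl i) (Sum.inr j) := by
    intro i j hij
    let f : D.throughLeft → Fin m := fun i => D'.throughMap ⟨i.1, hL.subset i.2⟩
    have hf : StrictMono f := fun i i' h => D'.throughMap_strictMono h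
    have hfr : Set.range f = Set.range D'.throughMap := by
      ext j
      constructor
      · rintro ⟨i, rfl⟩
        exact ⟨_, rfl⟩
      · rintro ⟨i, rfl⟩
        exact ⟨⟨i.1, hL.superset i.2⟩, rfl⟩
    have heq : D.throughMap = f := by
      refine (StrictMono.range_inj D.throughMap_strictMono hf).1 ?_
      rw [hfr, D.range_throughMap, D'.range_throughMap, hR]
    have hj : j = D.throughMap ⟨i, j, hij⟩ := D.rel_inr_unique hij (D.rel_throughMap ⟨i, j, hij⟩)
    rw [hj, heq]
    exact D'.rel_throughMap ⟨i, _⟩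
  refine Diagram.ext (D.pairing.eq_of_common D'.pairing fun x => ?_)
  refine ⟨_, D.pairing.partner_ne x, D.pairing.rel_partner x, ?_⟩
  have h := D.pairing.rel_partner x
  generalize D.pairing.partner x = y at h ⊢
  rcases x with i | j <;> rcases y with i' | j'
  · exact (hl _ _).1 h
  · exact hthrough _ _ h
  · exact D'.rel.symm' (hthrough _ _ (D.rel.symm' h))
  · exact (hr _ _).1 h

theorem Diagram.throughLines_eq (D : Diagram n m) : D.throughLines = D.throughLeft.ncard := rfl

theorem Diagram.throughLines_flip (D : Diagram n m) : D.flip.throughLines = D.throughLines := by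
  rw [Diagram.throughLines_eq, ← D.range_throughMap, ← Set.image_univ,
    Set.ncard_image_of_injective _ D.throughMap_strictMono.injective, Set.ncard_univ,
    Nat.card_coe_set_eq, Diagram.throughLines_eq]

theorem Diagram.throughLines_le (D : Diagram n m) : D.throughLines ≤ n := by
  have := Set.ncard_le_ncard (Set.subset_univ D.throughLeft)
  rwa [Set.ncard_univ, Nat.card_eq_fintype_card, Fintype.card_fin] at this

theorem Diagram.isMonic_iff (D : Diagram n m) :
    D.IsMonic ↔ ∀ j, ∃ i, D.rel (Sum.inl i) (Sum.inr j) := by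
  unfold Diagram.IsMonic
  rw [← D.throughLines_flip, Diagram.throughLines_eq]
  have := Set.eq_univ_iff_ncard D.flip.throughLeft
  rw [Nat.card_eq_fintype_card, Fintype.card_fin] at this
  rw [← this, Set.eq_univ_iff_forall]
  exact forall_congr' fun j => exists_congr fun i =>
    ⟨fun h => D.rel.symm' h, fun h => D.rel.symm' h⟩

/-- In `ZMod 2`, the constant 1 summed over all boundary points cancels along links. -/
theorem Diagram.even_add (D : Diagram n m) : Even (n + m) := by
  have h := sum_eq_zero_of_partner D.pairing (fun _ => 1) (fun _ => by decide)
  simp only [Finset.sum_const, Finset.card_univ, Fintype.card_sum, Fintype.card_fin,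
    nsmul_eq_mul, mul_one] at h
  exact (ZMod.natCast_eq_zero_iff_even).1 h

/-- Cutting a diagram through the middle of its through lines. -/
theorem Diagram.exists_half (D : Diagram n m) (hd : D.throughLines = d) :
    ∃ s : Diagram n d, s.IsMonic ∧
      ∀ i i', s.rel (Sum.inl i) (Sum.inl i') ↔ D.rel (Sum.inl i) (Sum.inl i') := by
  classical
  let T : Finset (Fin m) := D.flip.throughLeft.toFinset
  have hT : T.card = d := by
    rw [← hd, ← D.throughLines_flip, Diagram.throughLines_eq, Set.ncard_eq_toFinset_card']
  -- `φ` lists the right ends of the through lines from top to bottom. The half is the restriction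
  -- of `D` to the left side and these ends; `φ` being increasing keeps it planar.
  let φ := T.orderEmbOfFin hT
  have hφ : ∀ j, (∃ a, φ a = j) ↔ ∃ i, D.rel (Sum.inl i) (Sum.inr j) := by
    intro j
    have h1 : j ∈ Set.range φ ↔ j ∈ T := by rw [Finset.range_orderEmbOfFin]; rfl
    exact h1.trans (Set.mem_toFinset.trans (exists_congr fun i =>
      ⟨fun h => D.rel.symm' h, fun h => D.rel.symm' h⟩))
  let g : Fin n ⊕ Fin d → Fin n ⊕ Fin m := Sum.map id φ
  have hg : Function.Injective g := Sum.map_injective.2 ⟨Function.injective_id, φ.injective⟩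
  have hpos : ∀ x y, bdryPos x < bdryPos y → bdryPos (g x) < bdryPos (g y) := by
    rintro (x | x) (y | y) h <;> simp only [bdryPos, g, Sum.map_inl, Sum.map_inr, id] at h ⊢
    · exact h
    · omega
    · omega
    · have : φ y < φ x := φ.lt_iff_lt.2 (by rw [Fin.lt_def]; omega)
      rw [Fin.lt_def] at this
      omega
  have hrange : ∀ x, ∃ y, g y = D.pairing.partner (g x) := by
    intro x
    have h := D.pairing.rel_partner (g x)
    rcases hp : D.pairing.partner (g x) with i | j
    · exact ⟨Sum.inl i, rfl⟩
    · rw [hp] at h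
      have : ∃ i, D.rel (Sum.inl i) (Sum.inr j) := by
        rcases x with i | a
        · exact ⟨i, h⟩
        -- The right point `φ a` already ends a through line, so its partner is not on the right.
        · exfalso
          obtain ⟨i, hi⟩ := (hφ (φ a)).1 ⟨a, rfl⟩
          have h1 := D.pairing.partner_ne (g (Sum.inr a))
          rw [hp] at h1
          cases D.pairing.eq_of_rel h1 (by simp [g]) h (D.rel.symm' hi)
      obtain ⟨a, rfl⟩ := (hφ j).2 this
      exact ⟨Sum.inr a, rfl⟩
  let s : Diagram n d :=
    { rel := D.rel.comap g
      pairing := by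
        intro x
        obtain ⟨y, hy⟩ := hrange x
        refine ⟨y, ⟨?_, ?_⟩, ?_⟩
        · rintro rfl
          exact D.pairing.partner_ne _ hy.symm
        · rw [Setoid.comap_rel, hy]
          exact D.pairing.rel_partner _
        · rintro z ⟨h1, h2⟩
          exact hg ((D.pairing.eq_partner (hg.ne h1) h2).trans hy.symm)
      planar := fun a b c e h1 h2 h3 h4 h5 =>
        D.planar _ _ _ _ (hpos _ _ h1) (hpos _ _ h2) (hpos _ _ h3) h4 h5 }
  exact ⟨s, s.isMonic_iff.2 fun a => (hφ (φ a)).1 ⟨a, rfl⟩, fun i i' => Iff.rfl⟩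

/-- Every right point of a monic diagram ends a through line. This is why its left links alone
determine it. -/
theorem Diagram.IsMonic.rel_inr {s : Diagram n d} (hs : s.IsMonic) {a b : Fin d}
    (h : s.rel (Sum.inr a) (Sum.inr b)) : a = b := by
  obtain ⟨i, hi⟩ := s.isMonic_iff.1 hs a
  exact s.rel_inr_unique hi (s.rel.trans' hi h)

theorem Diagram.IsMonic.eq_of_left {s s' : Diagram n d} (hs : s.IsMonic) (hs' : s'.IsMonic)
    (h : ∀ i i', s.rel (Sum.inl i) (Sum.inl i') ↔ s'.rel (Sum.inl i) (Sum.inl i')) : s = s' := by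
  refine Diagram.eq_of_left_right h fun j j' => ⟨fun h => ?_, fun h => ?_⟩
  · rw [hs.rel_inr h]
  · rw [hs'.rel_inr h]

/-- For monic `t`, each through line of `s` continues to the right side, so the concatenation
creates no new link on the left. -/
theorem Diagram.comp_rel_left (s : Diagram n d) {t : Diagram m d} (ht : t.IsMonic)
    (i i' : Fin n) :
    (s.comp t.flip).rel (Sum.inl i) (Sum.inl i') ↔ s.rel (Sum.inl i) (Sum.inl i') := by
  refine ⟨fun h => ?_, fun h => compRel_left h⟩
  by_cases hne : i' = i
  · rw [hne]
  have h1 := s.pairing.partner_ne (Sum.inl i)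
  have h2 := s.pairing.rel_partner (Sum.inl i)
  rcases h3 : s.pairing.partner (Sum.inl i) with i'' | a
  · rw [h3] at h1 h2
    have h4 : i'' ≠ i := fun e => h1 (congrArg Sum.inl e)
    have h5 := (s.comp t.flip).pairing.eq_of_rel (Sum.inl_injective.ne hne)
      (Sum.inl_injective.ne h4) h (compRel_left h2)
    rwa [Sum.inl_injective h5]
  · rw [h3] at h2
    obtain ⟨j, hj⟩ := t.isMonic_iff.1 ht a
    cases (s.comp t.flip).pairing.eq_of_rel (Sum.inl_injective.ne hne) (by simp) h
      (compRel_through h2 (t.rel.symm' hj))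

theorem Diagram.comp_rel_right {s : Diagram n d} (hs : s.IsMonic) (t : Diagram m d)
    (j j' : Fin m) :
    (s.comp t.flip).rel (Sum.inr j) (Sum.inr j') ↔ t.rel (Sum.inl j) (Sum.inl j') := by
  rw [← Diagram.comp_rel_left t hs]
  have : t.comp s.flip = (s.comp t.flip).flip := by rw [Diagram.comp_flip, Diagram.flip_flip]
  rw [this]
  exact Iff.rfl

theorem Diagram.throughLines_congr {D : Diagram n m} {D' : Diagram n d}
    (h : ∀ i i', D.rel (Sum.inl i) (Sum.inl i') ↔ D'.rel (Sum.inl i) (Sum.inl i')) :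
    D.throughLines = D'.throughLines := by
  rw [Diagram.throughLines_eq, Diagram.throughLines_eq]
  congr 1
  ext i
  simp only [Diagram.mem_throughLeft_iff, h]

/-- Left links of the first factor survive, so only its through ends can remain through ends. -/
theorem Diagram.throughLines_comp_le (D : Diagram n m) (F : Diagram m d) :
    (D.comp F).throughLines ≤ D.throughLines := by
  refine Set.ncard_le_ncard (fun i hi => ?_) (Set.toFinite _)
  refine (D.mem_throughLeft_iff i).2 fun i' h => ?_
  exact ((D.comp F).mem_throughLeft_iff i).1 hi i' (compRel_left h)

theorem Diagram.throughLines_le_right (D : Diagram n m) : D.throughLines ≤ m := by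
  rw [← D.throughLines_flip]
  exact D.flip.throughLines_le

/-- The diagram `s t^*`. -/
def cellDiagram (N : ℕ) (x : (d : TLIndex N) × (TLMonic N d × TLMonic N d)) : Diagram N N :=
  x.2.1.1.comp x.2.2.1.flip

theorem throughLines_cellDiagram (x : (d : TLIndex N) × (TLMonic N d × TLMonic N d)) :
    (cellDiagram N x).throughLines = x.1.1 :=
  (Diagram.throughLines_congr (Diagram.comp_rel_left _ x.2.2.2)).trans x.2.1.2

/-- The number of through lines recovers `d`, the left links recover `s`, and the right links
recover `t`. -/
theorem cellDiagram_injective (N : ℕ) : Function.Injective (cellDiagram N) := by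
  intro x y h
  have hd : x.1 = y.1 := Subtype.ext (by
    rw [← throughLines_cellDiagram x, h, throughLines_cellDiagram])
  obtain ⟨d, s, t⟩ := x
  obtain ⟨d', s', t'⟩ := y
  obtain rfl : d = d' := hd
  have h1 : s = s' := Subtype.ext (s.2.eq_of_left s'.2 fun i i' => by
    rw [← Diagram.comp_rel_left s.1 t.2, ← Diagram.comp_rel_left s'.1 t'.2]
    exact iff_of_eq (congrArg (fun D => D.rel (Sum.inl i) (Sum.inl i')) h))
  have h2 : t = t' := Subtype.ext (t.2.eq_of_left t'.2 fun i i' => by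
    rw [← Diagram.comp_rel_right s.2 t.1, ← Diagram.comp_rel_right s'.2 t'.1]
    exact iff_of_eq (congrArg (fun D => D.rel (Sum.inr i) (Sum.inr i')) h))
  rw [h1, h2]

theorem exists_cellDiagram (D : Diagram N N) : ∃ x, cellDiagram N x = D := by
  obtain ⟨s, hs, hs'⟩ := D.exists_half rfl
  obtain ⟨t, ht, ht'⟩ := D.flip.exists_half D.throughLines_flip
  have hd : D.throughLines ≤ N ∧ D.throughLines ≡ N [MOD 2] := by
    refine ⟨D.throughLines_le, ?_⟩
    obtain ⟨c, hc⟩ := s.even_add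
    unfold Nat.ModEq
    omega
  refine ⟨⟨⟨_, hd⟩, ⟨s, hs⟩, ⟨t, ht⟩⟩, Diagram.eq_of_left_right (fun i i' => ?_) fun j j' => ?_⟩
  · exact (Diagram.comp_rel_left s ht i i').trans (hs' i i')
  · exact (Diagram.comp_rel_right hs t j j').trans (ht' j j')

end Factorization

/-! ### The cellular structure of the Temperley-Lieb algebra. -/

section Cells

variable {N : ℕ} {β : ℂ}

/-- No power of β appears: `s` is monic, so every middle point is connected to the left side. -/
theorem TLCell_eq (d : TLIndex N) (s t : TLMonic N d) :
    TLCell N β d s t = TL.ofDiagram β (cellDiagram N ⟨d, s, t⟩) := by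
  unfold TLCell TL.ofDiagram cellDiagram
  rw [compLin_single, loops_eq_zero_of_left (s.1.isMonic_iff.1 s.2)]
  simp
  rfl

theorem ofDiagram_mem_lowerSpan {D : Diagram N N} {d : TLIndex N} (h : D.throughLines < d.1) :
    TL.ofDiagram β D ∈ lowerSpan ℂ (TLCell N β) d := by
  obtain ⟨x, rfl⟩ := exists_cellDiagram D
  rw [throughLines_cellDiagram] at h
  exact Submodule.subset_span ⟨x.1, h, x.2.1, x.2.2, (TLCell_eq _ _ _).symm⟩

/-- The coefficient of a diagram. -/
noncomputable def TL.coeff (β : ℂ) (D : Diagram N N) : TL N β →ₗ[ℂ] ℂ :=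
  (Finsupp.lapply D : (Diagram N N →₀ ℂ) →ₗ[ℂ] ℂ)

theorem coeff_ofDiagram_self (D : Diagram N N) : TL.coeff β D (TL.ofDiagram β D) = 1 :=
  Finsupp.single_eq_same

theorem coeff_ofDiagram_of_ne {D F : Diagram N N} (h : D ≠ F) :
    TL.coeff β D (TL.ofDiagram β F) = 0 :=
  Finsupp.single_eq_of_ne h

theorem coeff_eq_zero_of_mem_lowerSpan {D : Diagram N N} {d : TLIndex N}
    (h : D.throughLines = d.1) {x : TL N β} (hx : x ∈ lowerSpan ℂ (TLCell N β) d) :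
    TL.coeff β D x = 0 := by
  have hle : lowerSpan ℂ (TLCell N β) d ≤ LinearMap.ker (TL.coeff β D) := by
    refine Submodule.span_le.2 ?_
    rintro _ ⟨e, he, p, q, rfl⟩
    rw [TLCell_eq]
    refine coeff_ofDiagram_of_ne ?_
    rintro rfl
    rw [throughLines_cellDiagram] at h
    have : e.1 < d.1 := he
    simp only at h
    omega
  exact hle hx

/-- The action of the Temperley-Lieb algebra on the cells. -/
theorem TLCell_mul (a : TL N β) (d : TLIndex N) [Fintype (TLMonic N d)] :
    ∃ r : TLMonic N d → TLMonic N d → ℂ, ∀ s t : TLMonic N d,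
      a * TLCell N β d s t - ∑ s', r s' s • TLCell N β d s' t ∈ lowerSpan ℂ (TLCell N β) d := by
  -- `L t` is multiplication by `t^*` on the right. By associativity `a C(s,t) = L t (a s)`, where
  -- `a s` is a combination of (N,d)-diagrams that does not involve `t`.
  let L : TLMonic N d → (Diagram N d.1 →₀ ℂ) →ₗ[ℂ] TL N β := fun t =>
    (compLin β N d.1 N).flip (Finsupp.single t.1.flip 1)
  have key : ∀ (w : Diagram N d.1 →₀ ℂ) (t : TLMonic N d),
      L t w - ∑ s' : TLMonic N d, w s'.1 • TLCell N β d s' t ∈ lowerSpan ℂ (TLCell N β) d := by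
    intro w t
    induction w using Finsupp.induction_linear with
    | zero =>
      simp only [map_zero, Finsupp.coe_zero, Pi.zero_apply, zero_smul, Finset.sum_const_zero,
        sub_zero]
      exact zero_mem _
    | add v w hv hw =>
      simp only [Finsupp.add_apply, add_smul, Finset.sum_add_distrib, map_add]
      rw [add_sub_add_comm]
      exact add_mem hv hw
    | single F c =>
      have hF : L t (Finsupp.single F c) =
          (c * β ^ loops F.rel t.1.flip.rel) • TL.ofDiagram β (F.comp t.1.flip) := by
        refine (compLin_single β F t.1.flip c 1).trans ?_
        refine Eq.trans ?_ (Finsupp.smul_single _ _ _).symm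
        rw [smul_eq_mul, mul_one, mul_one]
      by_cases hm : F.IsMonic
      · rw [Finset.sum_eq_single (⟨F, hm⟩ : TLMonic N d)]
        · rw [Finsupp.single_eq_same, TLCell_eq, hF,
            loops_eq_zero_of_left (F.isMonic_iff.1 hm), pow_zero, mul_one]
          rw [show F.comp t.1.flip = cellDiagram N ⟨d, ⟨F, hm⟩, t⟩ from rfl, sub_self]
          exact zero_mem _
        · intro s' _ hs'
          rw [Finsupp.single_eq_of_ne (fun e => hs' (Subtype.ext e)), zero_smul]
        · simp
      -- A diagram that is not monic has fewer than `d` through lines, and so has its product with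
      -- `t^*`.
      · rw [Finset.sum_eq_zero, sub_zero, hF]
        · refine Submodule.smul_mem _ _ (ofDiagram_mem_lowerSpan ?_)
          exact (F.throughLines_comp_le _).trans_lt (lt_of_le_of_ne F.throughLines_le_right hm)
        · intro s' _
          rw [Finsupp.single_eq_of_ne, zero_smul]
          rintro rfl
          exact hm s'.2
  -- The coefficient is that of `s'` in `a s`, hence independent of `t`.
  refine ⟨fun s' s => (compLin β N N d.1 a (Finsupp.single s.1 1)) s'.1, fun s t => ?_⟩
  have h := key (compLin β N N d.1 a (Finsupp.single s.1 1)) t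
  have hL : L t (compLin β N N d.1 a (Finsupp.single s.1 1)) = a * TLCell N β d s t :=
    compLin_assoc β (n := N) (m := N) a (Finsupp.single s.1 1) (Finsupp.single t.1.flip 1)
  rwa [hL] at h

end Cells
-- The mirror anti-involution.
section Mirror

variable {N : ℕ} {β : ℂ}

theorem ofDiagram_mul (D F : Diagram N N) :
    TL.ofDiagram β D * TL.ofDiagram β F =
      β ^ loops D.rel F.rel • TL.ofDiagram β (D.comp F) := by
  refine (compLin_single β D F 1 1).trans ?_
  refine Eq.trans ?_ (Finsupp.smul_single _ _ _).symm
  rw [smul_eq_mul, mul_one, one_mul, mul_one]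

theorem TL.induction {p : TL N β → Prop} (zero : p 0) (add : ∀ x y, p x → p y → p (x + y))
    (smul : ∀ (c : ℂ) (D : Diagram N N), p (c • TL.ofDiagram β D)) (x : TL N β) : p x := by
  induction x using Finsupp.induction_linear with
  | zero => exact zero
  | add x y hx hy => exact add x y hx hy
  | single D c =>
    have : (Finsupp.single D c : Diagram N N →₀ ℂ) = c • Finsupp.single D 1 := by simp
    rw [this]
    exact smul c D

theorem mirror_ofDiagram (D : Diagram N N) :
    TL.mirror N β (TL.ofDiagram β D) = TL.ofDiagram β D.flip :=
  Finsupp.mapDomain_single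

theorem mirror_mirror (x : TL N β) : TL.mirror N β (TL.mirror N β x) = x := by
  induction x using TL.induction with
  | zero => rw [map_zero, map_zero]
  | add x y hx hy => rw [map_add, map_add, hx, hy]
  | smul c D => rw [map_smul, map_smul, mirror_ofDiagram, mirror_ofDiagram, Diagram.flip_flip]

theorem mirror_mul (x y : TL N β) :
    TL.mirror N β (x * y) = TL.mirror N β y * TL.mirror N β x := by
  induction x using TL.induction with
  | zero => rw [zero_mul, map_zero, mul_zero]
  | add x x' hx hx' => rw [add_mul, map_add, map_add, mul_add, hx, hx']
  | smul c D =>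
    induction y using TL.induction with
    | zero => rw [mul_zero, map_zero, zero_mul]
    | add y y' hy hy' => rw [mul_add, map_add, map_add, add_mul, hy, hy']
    | smul b F =>
      simp only [smul_mul_assoc, mul_smul_comm, map_smul, ofDiagram_mul, mirror_ofDiagram]
      rw [Diagram.comp_flip, show loops F.flip.rel D.flip.rel = _ from loops_flip D.rel F.rel,
        smul_comm c b]

theorem mirror_one : TL.mirror N β 1 = 1 := by
  have h : (Diagram.one N).flip = Diagram.one N := by
    refine Diagram.eq_of_left_right (fun i i' => ?_) (fun i i' => ?_) <;>
    · change (Diagram.one N).rel _ _ ↔ _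
      rw [Diagram.one_rel]
      exact Iff.rfl
  have := mirror_ofDiagram (β := β) (Diagram.one N)
  rwa [h] at this

theorem mirror_E (i : ℕ) : TL.mirror N β (TL.E N β i) = TL.E N β i := by
  unfold TL.E
  split_ifs with h
  · rw [mirror_ofDiagram, (Diagram.isCupCap_cupCap (i - 1) (by omega)).flip_eq]
  · exact map_zero _

theorem mirror_wenzlJones (q : ℂ) (j : ℕ) :
    TL.mirror N (q + q⁻¹) (wenzlJones q N j) = wenzlJones q N j := by
  induction j using Nat.strong_induction_on with
  | _ j ih =>
    match j with
    | 0 => exact mirror_one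
    | 1 => exact mirror_one
    | j + 2 =>
      simp only [wenzlJones, map_sub, map_smul, mirror_mul, mirror_E, ih (j + 1) (by omega),
        mul_assoc]

end Mirror

/-! ### Temperley-Lieb relations for the generators. -/

section Relations

variable {N : ℕ} {β : ℂ}

theorem E_eq (i : ℕ) (h : i + 1 < N) :
    TL.E N β (i + 1) = TL.ofDiagram β (Diagram.cupCap N i h) :=
  dif_pos ⟨by omega, h⟩

/-- A diagram with a link between neighbours is an eigenvector of the generator at that place.
Besides the relation for E squared, this is what lets the projector kill such diagrams. -/
theorem E_mul_ofDiagram (i : ℕ) (h : i + 1 < N) {D : Diagram N N}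
    (hD : D.rel (Sum.inl ⟨i, by omega⟩) (Sum.inl ⟨i + 1, h⟩)) :
    TL.E N β (i + 1) * TL.ofDiagram β D = β • TL.ofDiagram β D := by
  rw [E_eq i h, ofDiagram_mul, (Diagram.isCupCap_cupCap i h).comp_eq hD,
    (Diagram.isCupCap_cupCap i h).loops_eq_one hD, pow_one]

theorem E_mul_self (i : ℕ) (h : i + 1 < N) :
    TL.E N β (i + 1) * TL.E N β (i + 1) = β • TL.E N β (i + 1) := by
  have := E_mul_ofDiagram (β := β) i h (Diagram.isCupCap_cupCap i h).left
  rwa [← E_eq i h] at this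

theorem E_mul_comm (i j : ℕ) (hi : i + 1 < j) (hj : j + 1 < N) :
    TL.E N β (i + 1) * TL.E N β (j + 1) = TL.E N β (j + 1) * TL.E N β (i + 1) := by
  have h := Diagram.isCupCap_cupCap (n := N) i (by omega)
  have h' := Diagram.isCupCap_cupCap (n := N) j hj
  rw [E_eq i (by omega), E_eq j hj, ofDiagram_mul, ofDiagram_mul]
  rw [h.comp_comm h', h.loops_eq_zero_of_disjoint h', h'.loops_eq_zero_of_disjoint h] <;>
    simp only [ne_eq, Fin.mk.injEq] <;> omega

theorem ofDiagram_mul_mul {D F : Diagram N N} {a b c : Fin N} (h : D.IsCupCap a b)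
    (h' : F.IsCupCap b c) (hac : a ≠ c) :
    TL.ofDiagram β D * TL.ofDiagram β F * TL.ofDiagram β D = TL.ofDiagram β D := by
  rw [ofDiagram_mul, h.loops_adjacent h' hac, pow_zero, one_smul, ofDiagram_mul,
    h.loops_adjacent' h' hac, pow_zero, one_smul, h.comp_comp_adjacent h' hac]

theorem E_mul_E_succ_mul_E (i : ℕ) (h : i + 2 < N) :
    TL.E N β (i + 1) * TL.E N β (i + 2) * TL.E N β (i + 1) = TL.E N β (i + 1) := by
  rw [E_eq i (by omega), E_eq (i + 1) h]
  exact ofDiagram_mul_mul (Diagram.isCupCap_cupCap i (by omega))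
    (Diagram.isCupCap_cupCap (i + 1) h) (by simp only [ne_eq, Fin.mk.injEq]; omega)

end Relations

/-! ### The Wenzl-Jones projector. -/

section WenzlJones

/-- The Wenzl-Jones recursion in an algebra with generators that satisfy the Temperley-Lieb
relations. -/
theorem wenzlJones_recursion {A : Type*} [Ring A] [Algebra ℂ A] (β : ℂ) (k : ℕ) (e P : ℕ → A)
    (c : ℕ → ℂ) (he : ∀ i, 1 ≤ i → i < k → e i * e i = β • e i)
    (hcomm : ∀ i j, 1 ≤ i → i + 2 ≤ j → j < k → e j * e i = e i * e j)
    (hadj : ∀ i, 1 ≤ i → i + 1 < k → e (i + 1) * e i * e (i + 1) = e (i + 1))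
    (hc : 2 ≤ k → c 0 * β = 1) (hc' : ∀ j, j + 3 ≤ k → c (j + 1) * (β - c j) = 1)
    (P0 : P 0 = 1) (P1 : P 1 = 1)
    (hP : ∀ j, j + 2 ≤ k → P (j + 2) = P (j + 1) - c j • (P (j + 1) * e (j + 1) * P (j + 1))) :
    ∀ j, j + 1 ≤ k → P (j + 1) * P (j + 1) = P (j + 1) ∧
      P j * P (j + 1) = P (j + 1) ∧ P (j + 1) * P j = P (j + 1) ∧
      (∀ i, 1 ≤ i → i ≤ j → e i * P (j + 1) = 0 ∧ P (j + 1) * e i = 0) ∧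
      (∀ i, j + 1 ≤ i → i < k → e i * P j = P j * e i) ∧
      (∀ i, j + 2 ≤ i → i < k → e i * P (j + 1) = P (j + 1) * e i) ∧
      (j + 2 ≤ k → ∃ b : ℂ, c j * b = 1 ∧ e (j + 1) * P (j + 1) * e (j + 1) =
        b • (e (j + 1) * P j)) := by
  intro j
  -- The statements must be proved together: annihilation at the next level uses the value of e P e,
  -- and that value uses annihilation-free data, namely idempotence and commutation with the
  -- generators further away. Here `e i` is counted from the bottom of the diagram.
  induction j with
  | zero =>
    intro _
    refine ⟨by simp [P1], by simp [P0, P1], by simp [P0, P1], fun i h1 h2 => by omega,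
      fun i _ _ => by simp [P0], fun i _ _ => by simp [P1], fun h => ⟨β, hc h, ?_⟩⟩
    simp only [zero_add, P0, P1, mul_one]
    exact he 1 le_rfl (by omega)
  | succ j ih =>
    intro hj
    obtain ⟨h1, h2, h3, h4, h5, h6, h7⟩ := ih (by omega)
    obtain ⟨b, hb, h7⟩ := h7 (by omega)
    have hR := hP j hj
    have h5' := h5 (j + 1) le_rfl (by omega)
    set Q := P (j + 1) with hQ
    set R := P (j + 2) with hRdef
    set f := e (j + 1) with hf
    have g1 : Q * R = R := by
      rw [hR, mul_sub, mul_smul_comm, h1, ← mul_assoc, ← mul_assoc, h1]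
    have g2 : R * Q = R := by
      rw [hR, sub_mul, smul_mul_assoc, h1, mul_assoc (Q * f), h1]
    have g3 : f * R = 0 := by
      -- From `f Q f = b f P_j` and `P_j Q = Q`; since `c j * b = 1`, the two terms of `f R` cancel.
      have : f * (Q * f * Q) = b • (f * Q) := by
        rw [← mul_assoc, ← mul_assoc, h7, smul_mul_assoc, mul_assoc, h2]
      rw [hR, mul_sub, mul_smul_comm, this, smul_smul, hb, one_smul, sub_self]
    have g4 : R * f = 0 := by
      have : Q * f * Q * f = b • (Q * f) := by
        rw [mul_assoc Q, mul_assoc Q, h7, mul_smul_comm, h5', ← mul_assoc, h3]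
      rw [hR, sub_mul, smul_mul_assoc, this, smul_smul, hb, one_smul, sub_self]
    refine ⟨?_, g1, g2, ?_, h6, ?_, ?_⟩
    -- Only the second factor is expanded; then `R Q = R` and `R f = 0` finish.
    · have : R * R = R * (Q - c j • (Q * f * Q)) := by rw [← hR]
      rw [this, mul_sub, mul_smul_comm, g2, ← mul_assoc, ← mul_assoc, g2, g4, zero_mul,
        smul_zero, sub_zero]
    · intro i hi hij
      rcases Nat.lt_or_ge i (j + 1) with h | h
      · obtain ⟨k1, k2⟩ := h4 i hi (by omega)
        constructor
        · rw [← g1, ← mul_assoc, k1, zero_mul]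
        · rw [← g2, mul_assoc, k2, mul_zero]
      · obtain rfl : i = j + 1 := by omega
        exact ⟨g3, g4⟩
    · intro i hi hik
      have k1 := h6 i (by omega) hik
      have k2 := hcomm (j + 1) i (by omega) (by omega) hik
      have : e i * (Q * f * Q) = Q * f * Q * e i := by
        rw [← mul_assoc, ← mul_assoc, k1, mul_assoc Q, k2, ← mul_assoc, mul_assoc (Q * f), k1,
          ← mul_assoc]
      rw [hR, mul_sub, sub_mul, mul_smul_comm, smul_mul_assoc, this, k1]
    · intro hjk
      -- In `g R g`, the term `g Q g` contributes β because `g` commutes with `Q`, and `g Q f Q g`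
      -- contributes one copy of `g Q` because `g f g = g`.
      refine ⟨β - c j, hc' j (by omega), ?_⟩
      have k1 := h6 (j + 2) le_rfl (by omega)
      have k2 := he (j + 2) (by omega) (by omega)
      have k3 := hadj (j + 1) (by omega) (by omega)
      change e (j + 2) * R * e (j + 2) = (β - c j) • (e (j + 2) * Q)
      change e (j + 2) * f * e (j + 2) = e (j + 2) at k3
      set g := e (j + 2)
      have m1 : g * Q * g = β • (g * Q) := by
        rw [k1, mul_assoc, k2, mul_smul_comm]
      have m2 : g * (Q * f * Q) * g = g * Q := by
        calc g * (Q * f * Q) * g = (g * Q) * f * (Q * g) := by simp only [mul_assoc]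
          _ = Q * g * f * (g * Q) := by rw [k1]
          _ = Q * (g * f * g) * Q := by simp only [mul_assoc]
          _ = g * Q := by rw [k3, ← k1, mul_assoc, h1]
      rw [hR, mul_sub, sub_mul, mul_smul_comm, smul_mul_assoc, m1, m2, sub_smul]

/-- The hypothesis `h1` keeps the denominator away from zero; with a zero denominator the quotient
would be zero by convention. -/
theorem qNumber_ne_zero {q : ℂ} (hq : q ≠ 0) {m : ℕ} (h1 : q ^ 2 ≠ 1) (hm : q ^ (2 * m) ≠ 1) :
    qNumber q m ≠ 0 := by
  have key : ∀ m : ℕ, q ^ (2 * m) ≠ 1 → q ^ m - q⁻¹ ^ m ≠ 0 := by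
    intro m hm h
    apply hm
    rw [sub_eq_zero] at h
    rw [two_mul, pow_add]
    nth_rewrite 2 [h]
    rw [← mul_pow, mul_inv_cancel₀ hq, one_pow]
  refine div_ne_zero (key m hm) ?_
  simpa using key 1 (by simpa using h1)

theorem qNumber_one {q : ℂ} (h : q - q⁻¹ ≠ 0) : qNumber q 1 = 1 := by
  simp [qNumber, div_self h]

theorem qNumber_two {q : ℂ} (h : q - q⁻¹ ≠ 0) : qNumber q 2 = q + q⁻¹ := by
  unfold qNumber
  rw [div_eq_iff h]
  ring

/-- The Chebyshev recursion; it turns β - [m]/[m+1] into [m+2]/[m+1], the inverse of the next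
coefficient of the projector. -/
theorem qNumber_add_two {q : ℂ} (hq : q ≠ 0) (m : ℕ) :
    qNumber q (m + 2) = (q + q⁻¹) * qNumber q (m + 1) - qNumber q m := by
  unfold qNumber
  rw [mul_div_assoc', ← sub_div]
  congr 1
  have : q * q⁻¹ = 1 := mul_inv_cancel₀ hq
  linear_combination (q ^ m - q⁻¹ ^ m) * (-this)

variable {q : ℂ} {N k : ℕ}

/-- The properties of the Wenzl-Jones projector. -/
theorem wenzlJones_spec (hq : q ≠ 0) (hk : 1 ≤ k) (hkN : k ≤ N)
    (h : ∀ m, 1 ≤ m → m ≤ k → q ^ (2 * m) ≠ 1) :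
    wenzlJones q N k * wenzlJones q N k = wenzlJones q N k ∧
      ∀ i, N < i + k → i < N → TL.E N (q + q⁻¹) i * wenzlJones q N k = 0 ∧
        wenzlJones q N k * TL.E N (q + q⁻¹) i = 0 := by
  have h1 : q ^ 2 ≠ 1 := h 1 le_rfl hk
  have hne : ∀ m, 1 ≤ m → m ≤ k → qNumber q m ≠ 0 :=
    fun m h2 h3 => qNumber_ne_zero hq h1 (h m h2 h3)
  have hqq : q - q⁻¹ ≠ 0 := by
    intro h0
    apply hne 1 le_rfl hk
    simp [qNumber, h0]
  obtain ⟨j, rfl⟩ : ∃ j, k = j + 1 := ⟨k - 1, by omega⟩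
  -- The generators are renumbered from the bottom, `i ↦ E_{N-i}`, so that the recursion no longer
  -- depends on `N`. The coefficients are `c i = [i+1]/[i+2]`.
  have key := wenzlJones_recursion (q + q⁻¹) (j + 1) (fun i => TL.E N (q + q⁻¹) (N - i))
    (wenzlJones q N) (fun i => qNumber q (i + 1) / qNumber q (i + 2)) ?_ ?_ ?_ ?_ ?_ rfl rfl ?_
    j le_rfl
  · refine ⟨key.1, fun i hi hiN => ?_⟩
    have := key.2.2.2.1 (N - i) (by omega) (by omega)
    rwa [show N - (N - i) = i by omega] at this
  · intro i h1 h2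
    obtain ⟨l, hl⟩ : ∃ l, N - i = l + 1 := ⟨N - i - 1, by omega⟩
    simp only [hl]
    exact E_mul_self l (by omega)
  · intro i i' h1 h2 h3
    obtain ⟨l, hl⟩ : ∃ l, N - i = l + 1 := ⟨N - i - 1, by omega⟩
    obtain ⟨l', hl'⟩ : ∃ l', N - i' = l' + 1 := ⟨N - i' - 1, by omega⟩
    simp only [hl, hl']
    exact E_mul_comm l' l (by omega) (by omega)
  · intro i h1 h2
    obtain ⟨l, hl⟩ : ∃ l, N - (i + 1) = l + 1 := ⟨N - (i + 1) - 1, by omega⟩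
    have hl' : N - i = l + 2 := by omega
    simp only [hl, hl']
    exact E_mul_E_succ_mul_E l (by omega)
  · intro h2
    have := hne 2 (by omega) h2
    rw [qNumber_two hqq] at this
    simp only [zero_add, qNumber_one hqq, qNumber_two hqq]
    exact one_div_mul_cancel this
  · intro i hi
    have h2 := hne (i + 2) (by omega) (by omega)
    have h3 := hne (i + 3) (by omega) (by omega)
    have h4 := qNumber_add_two hq (i + 1)
    change qNumber q (i + 2) / qNumber q (i + 3) * _ = 1
    change qNumber q (i + 3) = (q + q⁻¹) * qNumber q (i + 2) - _ at h4
    have h5 : q + q⁻¹ - qNumber q (i + 1) / qNumber q (i + 2) =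
        qNumber q (i + 3) / qNumber q (i + 2) := by
      rw [h4, sub_div, mul_div_cancel_right₀ _ h2]
    rw [h5, div_mul_div_cancel₀ h3, div_self h2]
  · intro i hi
    simp only [wenzlJones]
    rw [show N - (i + 2) + 1 = N - (i + 1) by omega]

end WenzlJones
-- Links among the bottom k points.
section BottomLinks

variable {n m k N d : ℕ}

/-- Two of the bottom `k` points on the left side are joined. -/
def Diagram.BottomLink (k : ℕ) (D : Diagram n m) : Prop :=
  ∃ i i' : Fin n, i ≠ i' ∧ n ≤ i + k ∧ n ≤ i' + k ∧ D.rel (Sum.inl i) (Sum.inl i')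

/-- Unless `i` and `i'` are neighbours, planarity forces the partner of `i + 1` to lie strictly
under the arc from `i` to `i'`. This is a shorter arc starting no higher than `i`, and `l` bounds
its length for the induction. -/
theorem Diagram.exists_adjacent_link (D : Diagram n m) (l : ℕ) :
    ∀ i i' : Fin n, i < i' → i'.1 - i.1 ≤ l → D.rel (Sum.inl i) (Sum.inl i') →
      ∃ (a : ℕ) (ha : a + 1 < n), i.1 ≤ a ∧
        D.rel (Sum.inl ⟨a, by omega⟩) (Sum.inl ⟨a + 1, ha⟩) := by
  induction l with
  | zero => intro i i' h1 h2; rw [Fin.lt_def] at h1; omega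
  | succ l ih =>
    intro i i' h1 h2 h3
    rw [Fin.lt_def] at h1
    by_cases h4 : i.1 + 1 = i'.1
    · refine ⟨i.1, by omega, le_rfl, ?_⟩
      rwa [show (⟨i.1 + 1, by omega⟩ : Fin n) = i' from Fin.ext h4]
    let j : Fin n := ⟨i.1 + 1, by omega⟩
    have hij : (Sum.inl i : Fin n ⊕ Fin m) ≠ Sum.inl i' :=
      Sum.inl_injective.ne (Fin.ne_of_lt h1)
    have h5 := D.pairing.partner_ne (Sum.inl j)
    have h6 := D.pairing.rel_partner (Sum.inl j)
    generalize D.pairing.partner (Sum.inl j) = p at h5 h6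
    have h7 := D.pairing.mem_pair_iff hij h3 h6
    have h8 : ¬ (p = Sum.inl i ∨ p = Sum.inl i') := by
      rw [← h7]
      simp only [Sum.inl.injEq, Fin.ext_iff, j]
      omega
    -- A partner beyond `i'`, or before `i`, would give a crossing. Right points come after all left
    -- points in `bdryPos`, so this also excludes through lines.
    have h9 : ¬ bdryPos (Sum.inl i' : Fin n ⊕ Fin m) < bdryPos p := fun h =>
      D.planar (Sum.inl i) (Sum.inl j) (Sum.inl i') p (by simp only [bdryPos, j]; omega)
        (by simp only [bdryPos, j]; omega) h h3 h6
    have h10 : ¬ bdryPos p < bdryPos (Sum.inl i : Fin n ⊕ Fin m) := fun h =>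
      D.planar p (Sum.inl i) (Sum.inl j) (Sum.inl i') h (by simp only [bdryPos, j]; omega)
        (by simp only [bdryPos, j]; omega) (D.rel.symm' h6) h3
    rcases p with p | p
    · simp only [bdryPos, Sum.inl.injEq, Fin.ext_iff, ne_eq, j] at h5 h8 h9 h10
      obtain ⟨a, ha, h11, h12⟩ := ih j p (by rw [Fin.lt_def]; simp only [j]; omega)
        (by simp only [j]; omega) h6
      exact ⟨a, ha, (Nat.le_succ _).trans h11, h12⟩
    · simp only [bdryPos] at h9
      omega

theorem Diagram.BottomLink.exists_adjacent {D : Diagram n m} (h : D.BottomLink k) :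
    ∃ (a : ℕ) (ha : a + 1 < n), n ≤ a + k ∧
      D.rel (Sum.inl ⟨a, by omega⟩) (Sum.inl ⟨a + 1, ha⟩) := by
  obtain ⟨i, i', h1, h2, h3, h4⟩ := h
  rcases lt_or_gt_of_ne h1 with h5 | h5
  · obtain ⟨a, ha, h6, h7⟩ := D.exists_adjacent_link _ i i' h5 le_rfl h4
    exact ⟨a, ha, by omega, h7⟩
  · obtain ⟨a, ha, h6, h7⟩ := D.exists_adjacent_link _ i' i h5 le_rfl (D.rel.symm' h4)
    exact ⟨a, ha, by omega, h7⟩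

theorem Diagram.BottomLink.comp {D : Diagram n m} (h : D.BottomLink k) (F : Diagram m d) :
    (D.comp F).BottomLink k := by
  obtain ⟨i, i', h1, h2, h3, h4⟩ := h
  exact ⟨i, i', h1, h2, h3, compRel_left h4⟩

/-- The left links of `s t^*` are those of `s`, so a bottom link is a property of `s` alone. -/
theorem bottomLink_cellDiagram (x : (d : TLIndex N) × (TLMonic N d × TLMonic N d)) :
    (cellDiagram N x).BottomLink k ↔ x.2.1.1.BottomLink k := by
  have h := Diagram.comp_rel_left x.2.1.1 x.2.2.2
  exact exists₂_congr fun i i' => by rw [cellDiagram, h i i']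

theorem bottomLink_cellDiagram_flip (x : (d : TLIndex N) × (TLMonic N d × TLMonic N d)) :
    (cellDiagram N x).flip.BottomLink k ↔ x.2.2.1.BottomLink k := by
  have h : (cellDiagram N x).flip = cellDiagram N ⟨x.1, x.2.2, x.2.1⟩ := by
    simp only [cellDiagram, Diagram.comp_flip, Diagram.flip_flip]
  rw [h, bottomLink_cellDiagram]

/-- The other end of the link at a point of the rainbow diagram. -/
def rainbowPartner (h n d : ℕ) (hn : n = 2 * h + d) : Fin n ⊕ Fin d → Fin n ⊕ Fin d
  | Sum.inl i => if hi : i.1 < 2 * h then Sum.inl ⟨2 * h - 1 - i.1, by omega⟩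
      else Sum.inr ⟨i.1 - 2 * h, by omega⟩
  | Sum.inr j => Sum.inl ⟨2 * h + j.1, by omega⟩

/-- The diagram which joins the points `i` and `2 h - 1 - i` for `i < h`, all other points being
the ends of through lines. -/
def Diagram.rainbow (h n d : ℕ) (hn : n = 2 * h + d) : Diagram n d :=
  Diagram.ofInvolution (rainbowPartner h n d hn)
    (by
      rintro (x | x)
      · by_cases hx : x.1 < 2 * h
        · simp only [rainbowPartner, hx, dif_pos]
          rw [dif_pos (by omega)]
          simp only [Sum.inl.injEq, Fin.ext_iff]
          omega
        · simp only [rainbowPartner, hx, dif_neg, Sum.inl.injEq, Fin.ext_iff,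
            not_false_eq_true]
          omega
      · simp [rainbowPartner])
    (by
      rintro (x | x)
      · by_cases hx : x.1 < 2 * h
        · simp only [rainbowPartner, hx, dif_pos, ne_eq, Sum.inl.injEq, Fin.ext_iff]
          omega
        · simp [rainbowPartner, hx]
      · simp [rainbowPartner])
    (by
      rintro (x | x) (y | y) <;> simp only [rainbowPartner] <;> (try split_ifs) <;>
        simp only [bdryPos] <;> omega)

theorem Diagram.rainbow_rel (h n d : ℕ) (hn : n = 2 * h + d) (x y : Fin n ⊕ Fin d) :
    (Diagram.rainbow h n d hn).rel x y ↔ y = x ∨ y = rainbowPartner h n d hn x :=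
  Iff.rfl

theorem Diagram.isMonic_rainbow (h n d : ℕ) (hn : n = 2 * h + d) :
    (Diagram.rainbow h n d hn).IsMonic := by
  refine (Diagram.isMonic_iff _).2 fun j => ⟨⟨2 * h + j.1, by omega⟩, ?_⟩
  rw [Diagram.rainbow_rel]
  simp [rainbowPartner]

/-- The upper end of every arc is among the top `h` points, and these lie above the bottom `k`. -/
theorem Diagram.not_bottomLink_rainbow (h n d : ℕ) (hn : n = 2 * h + d) (hk : h + k ≤ n) :
    ¬ (Diagram.rainbow h n d hn).BottomLink k := by
  rintro ⟨i, i', h1, h2, h3, h4⟩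
  rcases (Diagram.rainbow_rel _ _ _ _ _ _).1 h4 with h4 | h4
  · exact h1 (Sum.inl_injective h4).symm
  · by_cases hi : i.1 < 2 * h
    · simp only [rainbowPartner, hi, dif_pos, Sum.inl.injEq, Fin.ext_iff] at h4
      omega
    · simp [rainbowPartner, hi] at h4

/-- Pigeonhole: the partner map sends the `k` bottom points injectively to the other `n` left points
and the `d` right points. -/
theorem Diagram.le_of_not_bottomLink {s : Diagram (n + k) d} (h : ¬ s.BottomLink k) :
    k ≤ n + d := by
  have hg : ∀ j : Fin k, ∃ y : Fin n ⊕ Fin d,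
      Sum.map (Fin.castAdd k) id y = s.pairing.partner (Sum.inl (Fin.natAdd n j)) := by
    intro j
    have h1 := s.pairing.partner_ne (Sum.inl (Fin.natAdd n j))
    have h2 := s.pairing.rel_partner (Sum.inl (Fin.natAdd n j))
    generalize s.pairing.partner (Sum.inl (Fin.natAdd n j)) = p at h1 h2
    rcases p with i | a
    · by_cases hi : i.1 < n
      · exact ⟨Sum.inl ⟨i.1, hi⟩, rfl⟩
      · exact absurd ⟨Fin.natAdd n j, i, fun e => h1 (congrArg Sum.inl e.symm),
          by simp only [Fin.val_natAdd]; omega, by omega, h2⟩ h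
    · exact ⟨Sum.inr a, rfl⟩
  choose g hg using hg
  have hinj : Function.Injective g := by
    intro j j' hj
    have h1 := (hg j).symm.trans ((congrArg _ hj).trans (hg j'))
    have h2 := congrArg s.pairing.partner h1
    rw [IsPairing.partner_partner, IsPairing.partner_partner] at h2
    exact Fin.natAdd_injective _ _ (Sum.inl_injective h2)
  simpa using Fintype.card_le_of_injective g hinj

end BottomLinks

/-! ### The projector modulo diagrams with bottom links. -/

section BottomSpan

variable {N k : ℕ} {β : ℂ}

/-- The span of the diagrams which join two of the bottom `k` points on the left side. -/
noncomputable def leftBottomSpan (N k : ℕ) (β : ℂ) : Submodule ℂ (TL N β) :=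
  Submodule.span ℂ {x | ∃ D : Diagram N N, D.BottomLink k ∧ x = TL.ofDiagram β D}

/-- The span of the diagrams which join two of the bottom `k` points on the same side. -/
noncomputable def bottomSpan (N k : ℕ) (β : ℂ) : Submodule ℂ (TL N β) :=
  Submodule.span ℂ {x | ∃ D : Diagram N N, (D.BottomLink k ∨ D.flip.BottomLink k) ∧
    x = TL.ofDiagram β D}

/-- A right ideal, since left links survive multiplication on the right. -/
theorem leftBottomSpan_mul {x : TL N β} (hx : x ∈ leftBottomSpan N k β) (y : TL N β) :
    x * y ∈ leftBottomSpan N k β := by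
  induction hx using Submodule.span_induction with
  | zero => rw [zero_mul]; exact zero_mem _
  | add x x' _ _ hx hx' => rw [add_mul]; exact add_mem hx hx'
  | smul c x _ hx => rw [smul_mul_assoc]; exact Submodule.smul_mem _ _ hx
  | mem x hx =>
    obtain ⟨D, hD, rfl⟩ := hx
    induction y using TL.induction with
    | zero => rw [mul_zero]; exact zero_mem _
    | add y y' hy hy' => rw [mul_add]; exact add_mem hy hy'
    | smul c F =>
      rw [mul_smul_comm, ofDiagram_mul]
      exact Submodule.smul_mem _ _ (Submodule.smul_mem _ _
        (Submodule.subset_span ⟨_, hD.comp F, rfl⟩))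

theorem leftBottomSpan_le : leftBottomSpan N k β ≤ bottomSpan N k β :=
  Submodule.span_mono fun _ ⟨D, hD, h⟩ => ⟨D, Or.inl hD, h⟩

theorem mirror_mem_bottomSpan {x : TL N β} (hx : x ∈ bottomSpan N k β) :
    TL.mirror N β x ∈ bottomSpan N k β := by
  induction hx using Submodule.span_induction with
  | zero => rw [map_zero]; exact zero_mem _
  | add x x' _ _ hx hx' => rw [map_add]; exact add_mem hx hx'
  | smul c x _ hx => rw [map_smul]; exact Submodule.smul_mem _ _ hx
  | mem x hx =>
    obtain ⟨D, hD, rfl⟩ := hx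
    rw [mirror_ofDiagram]
    refine Submodule.subset_span ⟨_, ?_, rfl⟩
    rw [Diagram.flip_flip]
    exact hD.symm

theorem coeff_eq_zero_of_mem_bottomSpan {D : Diagram N N} (h : ¬ D.BottomLink k)
    (h' : ¬ D.flip.BottomLink k) {x : TL N β} (hx : x ∈ bottomSpan N k β) :
    TL.coeff β D x = 0 := by
  have hle : bottomSpan N k β ≤ LinearMap.ker (TL.coeff β D) := by
    refine Submodule.span_le.2 ?_
    rintro _ ⟨F, hF, rfl⟩
    refine coeff_ofDiagram_of_ne ?_
    rintro rfl
    exact hF.elim h h'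
  exact hle hx

/-- Each correction term starts on the left either with a generator on the bottom points or with `P
- 1` from the previous level, and the span is a right ideal. -/
theorem wenzlJones_sub_one_mem (q : ℂ) (j : ℕ) (hj : j ≤ k) (hk : k ≤ N) :
    wenzlJones q N j - 1 ∈ leftBottomSpan N k (q + q⁻¹) := by
  induction j using Nat.strong_induction_on with
  | _ j ih =>
    match j with
    | 0 => simp only [wenzlJones, sub_self]; exact zero_mem _
    | 1 => simp only [wenzlJones, sub_self]; exact zero_mem _
    | j + 2 =>
      have h1 := ih (j + 1) (by omega) (by omega)
      simp only [wenzlJones]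
      set P := wenzlJones q N (j + 1)
      have hE : TL.E N (q + q⁻¹) (N - (j + 2) + 1) ∈ leftBottomSpan N k (q + q⁻¹) := by
        rw [E_eq _ (by omega)]
        exact Submodule.subset_span ⟨_, ⟨_, _, (Diagram.isCupCap_cupCap _ _).ne,
          by simp only; omega, by simp only; omega, (Diagram.isCupCap_cupCap _ _).left⟩, rfl⟩
      set e := TL.E N (q + q⁻¹) (N - (j + 2) + 1)
      have h2 : P * e * P = e * P + (P - 1) * (e * P) := by
        rw [sub_mul, one_mul, mul_assoc]; abel
      rw [sub_right_comm, h2]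
      exact sub_mem h1 (Submodule.smul_mem _ _ (add_mem (leftBottomSpan_mul hE _)
        (leftBottomSpan_mul h1 _)))

variable {q : ℂ}

/-- Split P x P - x = (P - 1) x P + x (P - 1). The first term has bottom links on the left; the
second is the mirror image of such an element. -/
theorem wenzlJones_mul_mul_sub_mem (hk : k ≤ N) (x : TL N (q + q⁻¹)) :
    wenzlJones q N k * x * wenzlJones q N k - x ∈ bottomSpan N k (q + q⁻¹) := by
  have h := wenzlJones_sub_one_mem q k le_rfl hk
  have hm : TL.mirror N (q + q⁻¹)
      ((wenzlJones q N k - 1) * TL.mirror N (q + q⁻¹) x) = x * (wenzlJones q N k - 1) := by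
    rw [mirror_mul, mirror_mirror, map_sub, mirror_one, mirror_wenzlJones]
  have h1 := leftBottomSpan_le (leftBottomSpan_mul h (x * wenzlJones q N k))
  have h2 := mirror_mem_bottomSpan
    (leftBottomSpan_le (leftBottomSpan_mul h (TL.mirror N (q + q⁻¹) x)))
  rw [hm] at h2
  convert add_mem h1 h2 using 1
  rw [sub_mul, mul_sub, one_mul, mul_one, mul_assoc]
  abel

theorem wenzlJones_mul_ofDiagram (hq : q ≠ 0) (hk : 2 ≤ k) (hkN : k ≤ N)
    (h : ∀ m, 1 ≤ m → m ≤ k → q ^ (2 * m) ≠ 1) {D : Diagram N N} (hD : D.BottomLink k) :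
    wenzlJones q N k * TL.ofDiagram (q + q⁻¹) D = 0 := by
  obtain ⟨a, ha, h1, h2⟩ := hD.exists_adjacent
  -- q^4 - 1 = (q^3 - q)(q + q⁻¹), so β = 0 would contradict `h` at m = 2; this is where k ≥ 2
  -- enters.
  have hβ : q + q⁻¹ ≠ 0 := by
    intro h0
    apply h 2 (by omega) hk
    have : q * q⁻¹ = 1 := mul_inv_cancel₀ hq
    linear_combination (q ^ 3 - q) * h0 - (q ^ 2 - 1) * this
  have h3 := congrArg (wenzlJones q N k * ·) (E_mul_ofDiagram (β := q + q⁻¹) a ha h2)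
  simp only [← mul_assoc, mul_smul_comm] at h3
  rw [((wenzlJones_spec hq (by omega) hkN h).2 (a + 1) (by omega) ha).2, zero_mul] at h3
  exact (smul_eq_zero.1 h3.symm).resolve_left hβ

theorem ofDiagram_mul_wenzlJones (hq : q ≠ 0) (hk : 2 ≤ k) (hkN : k ≤ N)
    (h : ∀ m, 1 ≤ m → m ≤ k → q ^ (2 * m) ≠ 1) {D : Diagram N N} (hD : D.flip.BottomLink k) :
    TL.ofDiagram (q + q⁻¹) D * wenzlJones q N k = 0 := by
  have h1 := congrArg (TL.mirror N (q + q⁻¹)) (wenzlJones_mul_ofDiagram hq hk hkN h hD)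
  rwa [mirror_mul, mirror_ofDiagram, mirror_wenzlJones, Diagram.flip_flip, map_zero] at h1

end BottomSpan

/-! ### The cellular datum of the seam algebra. -/

section SeamAlgebra

variable {n k : ℕ} {q : ℂ}

/-- Without a bottom link in `s`, compression keeps the coefficient 1 of `s s^*`, while all diagrams
in the lower span have fewer through lines. Conversely a bottom link makes the product vanish
outright. -/
theorem mem_seamNull_iff (hq : q ≠ 0) (hk : 2 ≤ k) (h : ∀ m, 1 ≤ m → m ≤ k → q ^ (2 * m) ≠ 1)
    (d : TLIndex (n + k)) (s : TLMonic (n + k) d) :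
    s ∈ seamNull n k q d ↔ s.1.BottomLink k := by
  constructor
  · intro hs
    by_contra hb
    have h1 := coeff_eq_zero_of_mem_lowerSpan
      (throughLines_cellDiagram ⟨d, s, s⟩) (hs s)
    have h2 := coeff_eq_zero_of_mem_bottomSpan (k := k)
      (mt (bottomLink_cellDiagram ⟨d, s, s⟩).1 hb)
      (mt (bottomLink_cellDiagram_flip ⟨d, s, s⟩).1 hb)
      (wenzlJones_mul_mul_sub_mem (q := q) (by omega) (TLCell (n + k) (q + q⁻¹) d s s))
    rw [map_sub, h1, TLCell_eq, coeff_ofDiagram_self] at h2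
    norm_num at h2
  · intro hb t
    rw [TLCell_eq, wenzlJones_mul_ofDiagram hq hk (by omega) h
      ((bottomLink_cellDiagram ⟨d, s, t⟩).2 hb), zero_mul]
    exact zero_mem _

theorem range_seamIndex (hq : q ≠ 0) (hk : 2 ≤ k)
    (h : ∀ m, 1 ≤ m → m ≤ k → q ^ (2 * m) ≠ 1) :
    Set.range (fun d : SeamIndex n k q => (d.1.1 : ℕ)) =
      {d : ℕ | d ≡ n + k [MOD 2] ∧ 0 ≤ d ∧ d ≤ n + k ∧ k ≤ n + d} := by
  ext d
  constructor
  · rintro ⟨d, rfl⟩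
    refine ⟨d.1.2.2, Nat.zero_le _, d.1.2.1, ?_⟩
    obtain ⟨s, hs⟩ := (Set.ne_univ_iff_exists_notMem _).1 d.2
    exact Diagram.le_of_not_bottomLink (mt (mem_seamNull_iff hq hk h d.1 s).2 hs)
  · rintro ⟨h1, -, h2, h3⟩
    -- The number `l` of nested arcs; `k ≤ n + d` says exactly that `l ≤ n`, so their upper ends
    -- avoid the bottom `k` points.
    obtain ⟨l, hl⟩ : ∃ l, n + k = 2 * l + d := ⟨(n + k - d) / 2, by unfold Nat.ModEq at h1; omega⟩
    refine ⟨⟨⟨d, h2, h1⟩, (Set.ne_univ_iff_exists_notMem _).2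
      ⟨⟨Diagram.rainbow l (n + k) d hl, Diagram.isMonic_rainbow _ _ _ _⟩, ?_⟩⟩, rfl⟩
    rw [mem_seamNull_iff hq hk h]
    exact Diagram.not_bottomLink_rainbow _ _ _ _ (by omega)

/-- Compression to a corner. -/
noncomputable def toCorner {R A : Type*} [CommRing R] [Ring A] [Algebra R A] {e : A}
    (he : IsIdempotentElem e) : A →ₗ[R] he.Corner where
  toFun a := ⟨e * a * e, a, rfl⟩
  map_add' a b := Subtype.ext (by
    change e * (a + b) * e = e * a * e + e * b * e
    rw [mul_add, add_mul])
  map_smul' c a := Subtype.ext (by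
    change e * (c • a) * e = c • (e * a * e)
    rw [mul_smul_comm, smul_mul_assoc])

/-- The inclusion of a corner. -/
noncomputable def ofCorner {R A : Type*} [CommRing R] [Ring A] [Algebra R A] {e : A}
    (he : IsIdempotentElem e) : he.Corner →ₗ[R] A where
  toFun a := a.1
  map_add' _ _ := rfl
  map_smul' _ _ := rfl

theorem corner_mul_left {A : Type*} [Ring A] {e : A} (he : IsIdempotentElem e) (b : he.Corner) :
    e * b.1 = b.1 := by
  obtain ⟨a, ha⟩ := b.2
  rw [← ha, ← mul_assoc, ← mul_assoc, he.eq]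

theorem corner_mul_right {A : Type*} [Ring A] {e : A} (he : IsIdempotentElem e) (b : he.Corner) :
    b.1 * e = b.1 := by
  obtain ⟨a, ha⟩ := b.2
  rw [← ha, mul_assoc, he.eq]

theorem toCorner_val {R A : Type*} [CommRing R] [Ring A] [Algebra R A] {e : A}
    (he : IsIdempotentElem e) (b : he.Corner) : toCorner (R := R) he b.1 = b :=
  Subtype.ext (by
    change e * b.1 * e = b.1
    rw [corner_mul_left, corner_mul_right])

/-- The restriction of the mirror involution to the seam algebra. -/
noncomputable def seamMirror (hP : IsIdempotentElem (wenzlJones q (n + k) k)) :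
    SeamAlgebra n k q hP →ₗ[ℂ] SeamAlgebra n k q hP :=
  toCorner hP ∘ₗ TL.mirror (n + k) (q + q⁻¹) ∘ₗ ofCorner hP

/-- The compression in `seamMirror` only serves to land in the corner: P is fixed by the mirror, so
the image is already there. -/
theorem seamMirror_val (hP : IsIdempotentElem (wenzlJones q (n + k) k))
    (b : SeamAlgebra n k q hP) : (seamMirror hP b).1 = TL.mirror (n + k) (q + q⁻¹) b.1 := by
  change wenzlJones q (n + k) k * TL.mirror (n + k) (q + q⁻¹) b.1 * wenzlJones q (n + k) k = _
  have h := congrArg (TL.mirror (n + k) (q + q⁻¹))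
    ((congrArg (· * wenzlJones q (n + k) k) (corner_mul_left hP b)).trans (corner_mul_right hP b))
  simp only [mirror_mul, mirror_wenzlJones] at h
  rw [mul_assoc]
  exact h

/-- The definition of `seamNull` gives only vanishing modulo lower terms; exact vanishing, on either
index, is what spanning and the action require. -/
theorem toCorner_TLCell (hq : q ≠ 0) (hk : 2 ≤ k) (h : ∀ m, 1 ≤ m → m ≤ k → q ^ (2 * m) ≠ 1)
    (hP : IsIdempotentElem (wenzlJones q (n + k) k)) (d : TLIndex (n + k))
    (s t : TLMonic (n + k) d) (hst : s ∈ seamNull n k q d ∨ t ∈ seamNull n k q d) :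
    toCorner (R := ℂ) hP (TLCell (n + k) (q + q⁻¹) d s t) = 0 := by
  refine Subtype.ext ?_
  change wenzlJones q (n + k) k * TLCell (n + k) (q + q⁻¹) d s t * wenzlJones q (n + k) k = 0
  rw [TLCell_eq]
  rcases hst with hs | ht
  · rw [wenzlJones_mul_ofDiagram hq hk (by omega) h ((bottomLink_cellDiagram ⟨d, s, t⟩).2
      ((mem_seamNull_iff hq hk h d s).1 hs)), zero_mul]
  · rw [mul_assoc, ofDiagram_mul_wenzlJones hq hk (by omega) h
      ((bottomLink_cellDiagram_flip ⟨d, s, t⟩).2 ((mem_seamNull_iff hq hk h d t).1 ht)), mul_zero]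

/-- The coefficients at the diagrams `c x` form a dual family: none of these has a bottom link, so
compression does not change coefficients there. -/
theorem linearIndependent_seamCell (hq : q ≠ 0) (hk : 2 ≤ k)
    (h : ∀ m, 1 ≤ m → m ≤ k → q ^ (2 * m) ≠ 1)
    (hP : IsIdempotentElem (wenzlJones q (n + k) k)) :
    LinearIndependent ℂ (fun x : (d : SeamIndex n k q) × (SeamMonic n k q d × SeamMonic n k q d) =>
      seamCell n k q hP x.1 x.2.1 x.2.2) := by
  let c : ((d : SeamIndex n k q) × (SeamMonic n k q d × SeamMonic n k q d)) →
      Diagram (n + k) (n + k) := fun x => cellDiagram (n + k) ⟨x.1.1, x.2.1.1, x.2.2.1⟩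
  have hc : Function.Injective c := by
    rintro ⟨⟨d, hd⟩, ⟨s, hs⟩, ⟨t, ht⟩⟩ ⟨⟨d', hd'⟩, ⟨s', hs'⟩, ⟨t', ht'⟩⟩ hxy
    cases cellDiagram_injective (n + k) hxy
    rfl
  have key : ∀ x y, TL.coeff (q + q⁻¹) (c x) (seamCell n k q hP y.1 y.2.1 y.2.2).1 =
      TL.coeff (q + q⁻¹) (c x) (TL.ofDiagram (q + q⁻¹) (c y)) := by
    intro x y
    have hs : ¬ (c x).BottomLink k := by
      rw [bottomLink_cellDiagram, ← mem_seamNull_iff hq hk h]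
      exact x.2.1.2
    have ht : ¬ (c x).flip.BottomLink k := by
      rw [bottomLink_cellDiagram_flip, ← mem_seamNull_iff hq hk h]
      exact x.2.2.2
    have h1 := coeff_eq_zero_of_mem_bottomSpan hs ht (wenzlJones_mul_mul_sub_mem (q := q)
      (by omega) (TLCell (n + k) (q + q⁻¹) y.1.1 y.2.1.1 y.2.2.1))
    rw [map_sub, sub_eq_zero, TLCell_eq] at h1
    rw [← h1, ← TLCell_eq]
    rfl
  refine LinearIndependent.of_pairwise_dual_eq_zero_one _
    (fun x => TL.coeff (q + q⁻¹) (c x) ∘ₗ ofCorner hP) (fun x y hxy => ?_) (fun x => ?_)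
  · exact (key x y).trans (coeff_ofDiagram_of_ne (hc.ne hxy))
  · exact (key x x).trans (coeff_ofDiagram_self _)

theorem span_seamCell (hq : q ≠ 0) (hk : 2 ≤ k)
    (h : ∀ m, 1 ≤ m → m ≤ k → q ^ (2 * m) ≠ 1)
    (hP : IsIdempotentElem (wenzlJones q (n + k) k)) :
    Submodule.span ℂ (Set.range fun x : (d : SeamIndex n k q) ×
      (SeamMonic n k q d × SeamMonic n k q d) => seamCell n k q hP x.1 x.2.1 x.2.2) = ⊤ := by
  refine Submodule.eq_top_iff'.2 fun b => ?_
  rw [← toCorner_val (R := ℂ) hP b]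
  generalize b.1 = a
  induction a using TL.induction with
  | zero => rw [map_zero]; exact zero_mem _
  | add x y hx hy => rw [map_add]; exact add_mem hx hy
  | smul c D =>
    rw [map_smul]
    refine Submodule.smul_mem _ _ ?_
    obtain ⟨⟨d, s, t⟩, rfl⟩ := exists_cellDiagram D
    rw [← TLCell_eq]
    by_cases hst : s ∈ seamNull n k q d ∨ t ∈ seamNull n k q d
    · rw [toCorner_TLCell hq hk h hP d s t hst]
      exact zero_mem _
    · rw [not_or] at hst
      exact Submodule.subset_span ⟨⟨⟨d, (Set.ne_univ_iff_exists_notMem _).2 ⟨s, hst.1⟩⟩,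
        ⟨s, hst.1⟩, ⟨t, hst.2⟩⟩, rfl⟩

/-- A lower cell either compresses to zero or is one of the surviving lower cells, so no index `e <
d` outside the new poset is missed. -/
theorem toCorner_mem_lowerSpan (hq : q ≠ 0) (hk : 2 ≤ k)
    (h : ∀ m, 1 ≤ m → m ≤ k → q ^ (2 * m) ≠ 1)
    (hP : IsIdempotentElem (wenzlJones q (n + k) k)) (d : SeamIndex n k q)
    {x : TL (n + k) (q + q⁻¹)} (hx : x ∈ lowerSpan ℂ (TLCell (n + k) (q + q⁻¹)) d.1) :
    toCorner (R := ℂ) hP x ∈ lowerSpan ℂ (seamCell n k q hP) d := by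
  have hle : lowerSpan ℂ (TLCell (n + k) (q + q⁻¹)) d.1 ≤
      (lowerSpan ℂ (seamCell n k q hP) d).comap (toCorner (R := ℂ) hP) := by
    refine Submodule.span_le.2 ?_
    rintro _ ⟨e, he, s, t, rfl⟩
    change toCorner (R := ℂ) hP _ ∈ lowerSpan ℂ (seamCell n k q hP) d
    by_cases hst : s ∈ seamNull n k q e ∨ t ∈ seamNull n k q e
    · rw [toCorner_TLCell hq hk h hP e s t hst]
      exact zero_mem _
    · rw [not_or] at hst
      exact Submodule.subset_span ⟨⟨e, (Set.ne_univ_iff_exists_notMem _).2 ⟨s, hst.1⟩⟩, he,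
        ⟨s, hst.1⟩, ⟨t, hst.2⟩, rfl⟩
  exact hle hx

theorem seamCell_mul (hq : q ≠ 0) (hk : 2 ≤ k)
    (h : ∀ m, 1 ≤ m → m ≤ k → q ^ (2 * m) ≠ 1)
    (hP : IsIdempotentElem (wenzlJones q (n + k) k)) (a : SeamAlgebra n k q hP)
    (d : SeamIndex n k q) :
    ∃ r : SeamMonic n k q d → SeamMonic n k q d → ℂ, ∀ s t : SeamMonic n k q d,
      a * seamCell n k q hP d s t - ∑ s', r s' s • seamCell n k q hP d s' t ∈
        lowerSpan ℂ (seamCell n k q hP) d := by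
  classical
  have := Fintype.ofFinite (TLMonic (n + k) d.1)
  obtain ⟨r, hr⟩ := TLCell_mul a.1 d.1
  refine ⟨fun s' s => r s'.1 s.1, fun s t => ?_⟩
  have h1 := toCorner_mem_lowerSpan hq hk h hP d (hr s.1 t.1)
  -- An element of the corner absorbs P on both sides, so left multiplication by it commutes with
  -- compression.
  have h2 : toCorner (R := ℂ) hP (a.1 * TLCell (n + k) (q + q⁻¹) d.1 s.1 t.1) =
      a * seamCell n k q hP d s t := by
    refine Subtype.ext ?_
    change wenzlJones q (n + k) k * (a.1 * _) * wenzlJones q (n + k) k =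
      a.1 * (wenzlJones q (n + k) k * _ * wenzlJones q (n + k) k)
    rw [← mul_assoc, corner_mul_left, ← mul_assoc, ← mul_assoc, corner_mul_right]
  -- The null terms compress to zero, so the coefficients of TL can be reused on the smaller index
  -- set.
  have h3 : ∑ s' : TLMonic (n + k) d.1, r s' s.1 •
        toCorner (R := ℂ) hP (TLCell (n + k) (q + q⁻¹) d.1 s' t.1) =
      ∑ s' : SeamMonic n k q d, r s'.1 s.1 • seamCell n k q hP d s' t := by
    rw [← Finset.sum_filter_of_ne (p := fun s' => s' ∉ seamNull n k q d.1)]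
    · exact Finset.sum_subtype _ (fun s' => by simp) _
    · intro s' _ hne hs'
      rw [toCorner_TLCell hq hk h hP d.1 s' t.1 (Or.inl hs'), smul_zero] at hne
      exact hne rfl
  rw [map_sub, map_sum, h2] at h1
  simp only [map_smul] at h1
  rwa [h3] at h1

theorem isCellularDatum_seamCell (hq : q ≠ 0) (hk : 2 ≤ k)
    (h : ∀ m, 1 ≤ m → m ≤ k → q ^ (2 * m) ≠ 1)
    (hP : IsIdempotentElem (wenzlJones q (n + k) k)) :
    IsCellularDatum ℂ (seamCell n k q hP) (seamMirror hP) where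
  finite_poset := by
    have : Finite (TLIndex (n + k)) :=
      ((Set.finite_Iic (n + k)).subset fun d hd => hd.1 : {d | d ≤ n + k ∧ d ≡ n + k [MOD 2]}.Finite)
    exact inferInstance
  injective := (linearIndependent_seamCell hq hk h hP).injective
  linearIndependent := linearIndependent_seamCell hq hk h hP
  span_eq_top := span_seamCell hq hk h hP
  star_star a := Subtype.ext (by rw [seamMirror_val, seamMirror_val, mirror_mirror])
  star_mul a b := Subtype.ext (by
    change _ = (seamMirror hP b).1 * (seamMirror hP a).1
    rw [seamMirror_val, seamMirror_val, seamMirror_val]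
    exact mirror_mul a.1 b.1)
  star_C d s t := Subtype.ext (by
    rw [seamMirror_val]
    simp only [seamCell, mirror_mul, mirror_wenzlJones, TLCell_eq, mirror_ofDiagram, cellDiagram,
      Diagram.comp_flip, Diagram.flip_flip, mul_assoc])
  mul_C := seamCell_mul hq hk h hP

end SeamAlgebra
end TemperleyLieb

theorem mainTheorem5 (n k : ℕ) (hn : 1 ≤ n) (hk : 2 ≤ k) (q : ℂ) (hq : q ≠ 0)
    (hℓ : ∀ ℓ : ℕ, IsLeast {m : ℕ | 0 < m ∧ q ^ (2 * m) = 1} ℓ → k < ℓ) :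
    ∃ hP : IsIdempotentElem (TemperleyLieb.wenzlJones q (n + k) k),
      TemperleyLieb.IsCellular ℂ (TemperleyLieb.SeamAlgebra n k q hP) ∧
      (∃ star : TemperleyLieb.SeamAlgebra n k q hP →ₗ[ℂ] TemperleyLieb.SeamAlgebra n k q hP,
        (∀ b, (star b).1 = TemperleyLieb.TL.mirror (n + k) (q + q⁻¹) b.1) ∧
        TemperleyLieb.IsCellularDatum ℂ (TemperleyLieb.seamCell n k q hP) star) ∧
      Set.range (fun d : TemperleyLieb.SeamIndex n k q => (d.1.1 : ℕ)) =
        {d : ℕ | d ≡ n + k [MOD 2] ∧ 0 ≤ d ∧ d ≤ n + k ∧ k ≤ n + d} := by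
  classical
  have h : ∀ m, 1 ≤ m → m ≤ k → q ^ (2 * m) ≠ 1 := by
    intro m h1 h2 h3
    have hex : ∃ m, 0 < m ∧ q ^ (2 * m) = 1 := ⟨m, h1, h3⟩
    -- An exponent m ≤ k with q^(2m) = 1 would make a least one exist, and `hℓ` puts that beyond k.
    -- If q is not a root of unity, `hℓ` is vacuous.
    have := hℓ (Nat.find hex) ⟨Nat.find_spec hex, fun _ hl => Nat.find_min' hex hl⟩
    have := Nat.find_min' hex ⟨h1, h3⟩
    omega
  have hP : IsIdempotentElem (TemperleyLieb.wenzlJones q (n + k) k) :=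
    (TemperleyLieb.wenzlJones_spec hq (by omega) (by omega) h).1
  have hC := TemperleyLieb.isCellularDatum_seamCell hq hk h hP
  exact ⟨hP, ⟨_, _, _, _, _, _, hC⟩, ⟨_, TemperleyLieb.seamMirror_val hP, hC⟩,
    TemperleyLieb.range_seamIndex hq hk h⟩
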